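/- Let $d\ge 2$ and $0<\mu\le \frac1{10}$. Consider the two-sample dataset $b_1=(1,1,\dots,1)^\top\in\mathbb R^d$, $y_1=1$ and $b_2=(1+\mu,1,\dots,1)^\top\in\mathbb R^d$, $y_2=-1$, and put $a_i=y_ib_i$. Let $\mathbf P\in\mathbb R^{d\times d}$ be the cyclic shift $(\mathbf P b)_i=b_{i-1}$ (indices mod $d$) and $$\mathbf A_i=\begin{bmatrix}0&0&a_i^\top\\0&0&a_i^\top\mathbf P^\top\\a_i&\mathbf P a_i&\mathbf 0_d\end{bmatrix}\in\mathbb R^{(d+2)\times(d+2)},\qquad i=1,2.$$ For $\theta=(c_1,c_2,v)\in\mathbb R^{2}\times\mathbb R^{d}$ one has $\frac12\theta^\top\mathbf A_i\theta=y_i\,(c_1b_i+c_2\mathbf Pb_i)^\top v$; we call $\theta$ a separator if $\theta^\top\mathbf A_1\theta>0$ and $\theta^\top\mathbf A_2\theta>0$. Given $\theta_0\in\mathbb R^{d+2}$, the noisy two-sample quadratic perceptron algorithm with step size $\gamma$ and noise level $\sigma$ is $$\theta_{t+1}=\begin{cases}\theta_t+\gamma\mathbf A_1\theta_t+\xi_t,&\text{if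 }\theta_t^\top\mathbf A_1\theta_t\le 0,\\ \theta_t+\gamma\mathbf A_2\theta_t+\xi_t,&\text{if }\theta_t^\top\mathbf A_1\theta_t>0\text{ and }\theta_t^\top\mathbf A_2\theta_t\le 0,\end{cases}$$ where $\xi_0,\xi_1,\dots$ are i.i.d. $\mathcal N(0,\sigma^2\mathbf I_{d+2})$; it is run until $\theta_t$ is a separator. Let $v_{\mu,+}$ be a unit eigenvector of $\mathbf A_2$ for the eigenvalue $\mu$ (it is unique up to sign), let $0<\rho\le1$, let $\langle\theta_0,v_{\mu,+}\rangle\ne0$, and define $$A=2^{27}\log\Big(\frac{2^{62}\|\theta_0\|^2}{\rho^3\langle\theta_0,v_{\mu,+}\rangle^2}\Big)\log\Big(\frac{2^{15}\sqrt d\,\|\theta_0\|^2}{\mu\langle\theta_0,v_{\mu,+}\rangle^2}\Big),\quad B=A\log\Big(\frac{\sqrt d}{\mu}A\Big),\quad T=\Big\lceil B\,\frac{\sqrt d}{\mu}\Big\rceil,$$ $$\gamma=\frac1{4\sqrt d},\qquad \sigma=\frac{|\langle\theta_0,v_{\mu,+}\rangle|}{4096\,T\sqrt{\max\{d,\log(T/\rho)\}}}.$$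 Then, with probability at least $1-\rho$, the algorithm with this $\gamma$ and $\sigma$ finds a separator after at most $T$ steps, that is, some $\theta_t$ with $0\le t\le T$ is a separator. Moreover $A=\tilde\Theta(1)$, $B=\tilde\Theta(1)$ and $T=\tilde\Theta(\sqrt d/\mu)$: with $L=\log\big(\sqrt d\,\|\theta_0\|^2/(\mu\rho\langle\theta_0,v_{\mu,+}\rangle^2)\big)$ there is an absolute constant $C>0$ such that $$1\le A\le CL^2,\qquad 1\le B\le CL^3,\qquad \frac{\sqrt d}{\mu}\le T\le CL^3\,\frac{\sqrt d}{\mu}.$$ -/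

import Mathlib

open MeasureTheory ProbabilityTheory
open scoped Matrix

noncomputable section

namespace QuadPerceptron

/-- The parameter space `ℝ^{d+2}` with its Euclidean norm.  A parameter `θ = (c₁, c₂, v)` consists of
the kernel `c ∈ ℝ²` (block `Fin 2`) and of the weights `v ∈ ℝ^d` (block `Fin d`). -/
abbrev Param (d : ℕ) : Type := EuclideanSpace ℝ (Fin 2 ⊕ Fin d)

/-- The permutation matrix `P` that shifts coordinates circularly to the right:
`(P b)_i = b_{i-1}`, indices modulo `d`. -/
def shift (d : ℕ) : Matrix (Fin d) (Fin d) ℝ :=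
  Matrix.of fun i j => if (i : ℕ) = ((j : ℕ) + 1) % d then 1 else 0

/-- The `2 × d` matrix with rows `aᵀ` and `(P a)ᵀ`. -/
def rowsMat {d : ℕ} (a : Fin d → ℝ) : Matrix (Fin 2) (Fin d) ℝ :=
  Matrix.of ![a, shift d *ᵥ a]

/-- The symmetric `(d+2) × (d+2)` matrix `A = [0, 0, aᵀ; 0, 0, aᵀ Pᵀ; a, P a, 0]`. -/
def sampleMat {d : ℕ} (a : Fin d → ℝ) : Matrix (Fin 2 ⊕ Fin d) (Fin 2 ⊕ Fin d) ℝ :=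
  Matrix.fromBlocks 0 (rowsMat a) (rowsMat a)ᵀ 0

/-- The matrix acting as a linear map on `ℝ^{d+2}`. -/
def act {d : ℕ} (A : Matrix (Fin 2 ⊕ Fin d) (Fin 2 ⊕ Fin d) ℝ) (θ : Param d) : Param d :=
  WithLp.toLp 2 (A *ᵥ θ.ofLp)

/-- The quadratic form `θᵀ A θ`. -/
def quad {d : ℕ} (A : Matrix (Fin 2 ⊕ Fin d) (Fin 2 ⊕ Fin d) ℝ) (θ : Param d) : ℝ :=
  θ.ofLp ⬝ᵥ (A *ᵥ θ.ofLp)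

/-- First feature vector `b₁ = (1, …, 1)`; its label is `y₁ = 1`. -/
def b1 (d : ℕ) : Fin d → ℝ := fun _ => 1

/-- Second feature vector `b₂ = (1 + μ, 1, …, 1)`; its label is `y₂ = -1`. -/
def b2 (d : ℕ) (μ : ℝ) : Fin d → ℝ := fun i => if (i : ℕ) = 0 then 1 + μ else 1

/-- The label `y₁`. -/
def y1 : ℝ := 1

/-- The label `y₂`. -/
def y2 : ℝ := -1

/-- `A₁`, the matrix of the first sample. -/
def A1 (d : ℕ) : Matrix (Fin 2 ⊕ Fin d) (Fin 2 ⊕ Fin d) ℝ := sampleMat (y1 • b1 d)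

/-- `A₂`, the matrix of the second sample. -/
def A2 (d : ℕ) (μ : ℝ) : Matrix (Fin 2 ⊕ Fin d) (Fin 2 ⊕ Fin d) ℝ := sampleMat (y2 • b2 d μ)

/-- The convolutional model with kernel size `2`: `(c ∗ b)ᵀ v` with `c ∗ b = c₁ b + c₂ P b`. -/
def model {d : ℕ} (b : Fin d → ℝ) (θ : Param d) : ℝ :=
  (θ (Sum.inl 0) • b + θ (Sum.inl 1) • (shift d *ᵥ b)) ⬝ᵥ fun i => θ (Sum.inr i)

/-- `θ` is a separator of the two-sample dataset: the model classifies both samples correctly. -/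
def IsSeparator (d : ℕ) (μ : ℝ) (θ : Param d) : Prop :=
  0 < y1 * model (b1 d) θ ∧ 0 < y2 * model (b2 d μ) θ

/-- One step of the noisy two-sample quadratic perceptron algorithm with step size `γ` and noise
vector `ξ`.  When neither test fires (both quadratic forms are positive) the algorithm has stopped
and the point stays where it is. -/
def step (d : ℕ) (μ γ : ℝ) (θ ξ : Param d) : Param d :=
  if quad (A1 d) θ ≤ 0 then θ + γ • act (A1 d) θ + ξ
  else if quad (A2 d μ) θ ≤ 0 then θ + γ • act (A2 d μ) θ + ξ
  else θ

/-- The iterates `θ₀, θ₁, θ₂, …` of the algorithm driven by the noise sequence `ξ`. -/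
def iterates (d : ℕ) (μ γ : ℝ) (θ₀ : Param d) (ξ : ℕ → Param d) : ℕ → Param d
  | 0 => θ₀
  | t + 1 => step d μ γ (iterates d μ γ θ₀ ξ t) (ξ t)

/-- The step size `γ = 1 / (4 √d)`. -/
def stepSize (d : ℕ) : ℝ := 1 / (4 * √(d : ℝ))

/-- `A = 2^27 log(2^62 ‖θ₀‖² / (ρ³ ⟨θ₀, v⟩²)) log(2^15 √d ‖θ₀‖² / (μ ⟨θ₀, v⟩²))`. -/
def constA (d : ℕ) (μ ρ : ℝ) (θ₀ v : Param d) : ℝ :=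
  2 ^ 27 * Real.log (2 ^ 62 * ‖θ₀‖ ^ 2 / (ρ ^ 3 * inner ℝ θ₀ v ^ 2)) *
    Real.log (2 ^ 15 * √(d : ℝ) * ‖θ₀‖ ^ 2 / (μ * inner ℝ θ₀ v ^ 2))

/-- `B = A log(√d A / μ)`. -/
def constB (d : ℕ) (μ ρ : ℝ) (θ₀ v : Param d) : ℝ :=
  constA d μ ρ θ₀ v * Real.log (√(d : ℝ) / μ * constA d μ ρ θ₀ v)

/-- The number of steps `T = ⌈B √d / μ⌉`. -/
def stepsT (d : ℕ) (μ ρ : ℝ) (θ₀ v : Param d) : ℕ :=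
  ⌈constB d μ ρ θ₀ v * (√(d : ℝ) / μ)⌉₊

/-- The noise level `σ = |⟨θ₀, v⟩| / (4096 T √(max {d, log (T / ρ)}))`. -/
def noiseLevel (d : ℕ) (μ ρ : ℝ) (θ₀ v : Param d) : ℝ :=
  |inner ℝ θ₀ v| / (4096 * (stepsT d μ ρ θ₀ v : ℝ) *
    √(max (d : ℝ) (Real.log ((stepsT d μ ρ θ₀ v : ℝ) / ρ))))

/-- The quantity `log(√d ‖θ₀‖² / (μ ρ ⟨θ₀, v⟩²))` whose powers are the logarithmic factors hidden
by the notation `Θ̃`. -/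
def logFactor (d : ℕ) (μ ρ : ℝ) (θ₀ v : Param d) : ℝ :=
  Real.log (√(d : ℝ) * ‖θ₀‖ ^ 2 / (μ * ρ * inner ℝ θ₀ v ^ 2))

/-- `θᵀ A θ = 2 y (c ∗ b)ᵀ v` for the matrix `A` of the sample `(b, y)`. -/
theorem quad_sampleMat {d : ℕ} (y : ℝ) (b : Fin d → ℝ) (θ : Param d) :
    quad (sampleMat (y • b)) θ = 2 * (y * model b θ) := by
  simp only [quad, sampleMat, rowsMat, model, dotProduct, Matrix.mulVec, Fintype.sum_sum_type,
    Matrix.fromBlocks_apply₁₁, Matrix.fromBlocks_apply₁₂, Matrix.fromBlocks_apply₂₁,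
    Matrix.fromBlocks_apply₂₂, Matrix.zero_apply, zero_mul, Finset.sum_const_zero, zero_add,
    add_zero, Fin.sum_univ_two, Matrix.transpose_apply, Matrix.of_apply, Matrix.cons_val_zero,
    Matrix.cons_val_one, Pi.smul_apply, Pi.add_apply, smul_eq_mul]
  have h : ∀ i : Fin d, ∑ x, shift d i x * (y * b x) = y * ∑ x, shift d i x * b x := by
    intro i
    rw [Finset.mul_sum]
    exact Finset.sum_congr rfl fun x _ => by ring
  simp only [h, Finset.mul_sum, ← Finset.sum_add_distrib]
  refine Finset.sum_congr rfl fun i _ => ?_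
  simp only [← Finset.mul_sum]
  ring

/-- The algorithm stops exactly at the separators. -/
theorem isSeparator_iff (d : ℕ) (μ : ℝ) (θ : Param d) :
    IsSeparator d μ θ ↔ 0 < quad (A1 d) θ ∧ 0 < quad (A2 d μ) θ := by
  simp only [IsSeparator, A1, A2, quad_sampleMat, zero_lt_two, mul_pos_iff_of_pos_left]

end QuadPerceptron

end

/-! Write a = c₁ + c₂, Y = (∑ vᵢ)/√d, ε = γμ and α = |⟨θ₀, v⟩|. The test for sample 1 only sees the
sign of aY. The proof compares two growth rates. The eigenvector v lies in the kernel of A₁, so, up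
to noise, a step along A₁ keeps the correlation with v and a step along A₂ multiplies it by 1 + ε.
The norm grows more slowly: with Φ = ‖θ‖² + |a² - 2Y²|, a step along A₁ does not increase Φ
(`potential_step_A1_le`), and a step along A₂ at a non-separator multiplies √Φ by at most 1 + 3ε/4
(`potential_step_A2_le`). Since the correlation cannot exceed the norm and the total noise is small
against α, the number N of steps along A₂ satisfies (1 + ε)^N ≤ (4‖θ₀‖/α)^5 (`growth_comparison`).

It remains to exclude long runs of steps along A₁. Such steps expand the coordinate `escape` by 1 +
√2/4, and once it exceeds twice the norm the test for sample 1 is passed (`quad_A1_pos_of_escape`).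
The Gaussian noise at the start of a run keeps this coordinate from being too small, whatever the
other noise does (`measureReal_escape_le`), so logarithmically many steps suffice.

Hence each block of about K steps contains a step along A₂, and J blocks contradict the bound on N
(`exists_separator`). This part is deterministic; it fails only on 2T bad events, a large noise
vector or a small escape coordinate at some time, each of probability at most ρ/(2T). -/

noncomputable section

namespace QuadPerceptron

/-! ### Coordinate formulas for A₁ and A₂, and the kernel of A₁. -/

/-- The sum of the two kernel coordinates. -/
def kernelSum {d : ℕ} (θ : Param d) : ℝ := θ (Sum.inl 0) + θ (Sum.inl 1)

/-- The sum of the weight coordinates. -/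
def weightSum {d : ℕ} (θ : Param d) : ℝ := ∑ i, θ (Sum.inr i)

theorem shift_mulVec (n : ℕ) (b : Fin (n + 2) → ℝ) (i : Fin (n + 2)) :
    (shift (n + 2) *ᵥ b) i = b (i - 1) := by
  have h : ∀ j : Fin (n + 2), ((i : ℕ) = ((j : ℕ) + 1) % (n + 2)) ↔ j = i - 1 := by
    intro j
    have : ((j : ℕ) + 1) % (n + 2) = ((j + 1 : Fin (n + 2)) : ℕ) := by
      rw [Fin.val_add, Fin.val_one]
    rw [this, ← Fin.ext_iff, eq_sub_iff_add_eq, eq_comm]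
  change ∑ j : Fin (n + 2), (if (i : ℕ) = ((j : ℕ) + 1) % (n + 2) then (1 : ℝ) else 0) * b j = _
  rw [Finset.sum_eq_single_of_mem (i - 1) (Finset.mem_univ _) fun j _ hj => by
    rw [if_neg (mt (h j).1 hj), zero_mul], if_pos ((h _).2 rfl), one_mul]

theorem shift_b1 (n : ℕ) : shift (n + 2) *ᵥ b1 (n + 2) = b1 (n + 2) := by
  ext i; rw [shift_mulVec]; rfl

theorem b2_apply (n : ℕ) (μ : ℝ) (i : Fin (n + 2)) :
    b2 (n + 2) μ i = if i = 0 then 1 + μ else 1 := by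
  simp only [b2, Fin.ext_iff, Fin.val_zero]

theorem shift_b2_apply (n : ℕ) (μ : ℝ) (i : Fin (n + 2)) :
    (shift (n + 2) *ᵥ b2 (n + 2) μ) i = if i = 1 then 1 + μ else 1 := by
  rw [shift_mulVec, b2_apply]; simp [sub_eq_zero]

theorem act_sampleMat_inl_zero {d : ℕ} (a : Fin d → ℝ) (θ : Param d) :
    act (sampleMat a) θ (Sum.inl 0) = ∑ i, a i * θ (Sum.inr i) := by
  simp [act, sampleMat, rowsMat, Matrix.mulVec, dotProduct]

theorem act_sampleMat_inl_one {d : ℕ} (a : Fin d → ℝ) (θ : Param d) :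
    act (sampleMat a) θ (Sum.inl 1) = ∑ i, (shift d *ᵥ a) i * θ (Sum.inr i) := by
  simp [act, sampleMat, rowsMat, Matrix.mulVec, dotProduct]

theorem act_sampleMat_inr {d : ℕ} (a : Fin d → ℝ) (θ : Param d) (i : Fin d) :
    act (sampleMat a) θ (Sum.inr i) =
      a i * θ (Sum.inl 0) + (shift d *ᵥ a) i * θ (Sum.inl 1) := by
  simp [act, sampleMat, rowsMat, Matrix.mulVec, dotProduct]

theorem act_A1_inl (n : ℕ) (θ : Param (n + 2)) (j : Fin 2) :
    act (A1 (n + 2)) θ (Sum.inl j) = weightSum θ := by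
  fin_cases j
  · simp [A1, y1, act_sampleMat_inl_zero, weightSum, b1]
  · simp [A1, y1, act_sampleMat_inl_one, shift_b1, weightSum, b1]

theorem act_A1_inr (n : ℕ) (θ : Param (n + 2)) (i : Fin (n + 2)) :
    act (A1 (n + 2)) θ (Sum.inr i) = kernelSum θ := by
  simp [A1, y1, act_sampleMat_inr, shift_b1, kernelSum, b1]

theorem act_A2_inl_zero (n : ℕ) (μ : ℝ) (θ : Param (n + 2)) :
    act (A2 (n + 2) μ) θ (Sum.inl 0) = -(weightSum θ + μ * θ (Sum.inr 0)) := by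
  rw [A2, act_sampleMat_inl_zero]
  simp only [y2, Pi.smul_apply, b2_apply, weightSum, Fin.sum_univ_succ, smul_eq_mul]
  simp [Fin.succ_ne_zero]
  ring

theorem act_A2_inl_one (n : ℕ) (μ : ℝ) (θ : Param (n + 2)) :
    act (A2 (n + 2) μ) θ (Sum.inl 1) = -(weightSum θ + μ * θ (Sum.inr 1)) := by
  rw [A2, act_sampleMat_inl_one, Matrix.mulVec_smul]
  simp only [y2, Pi.smul_apply, shift_b2_apply, weightSum, smul_eq_mul]
  rw [← Finset.add_sum_erase _ _ (Finset.mem_univ (1 : Fin (n + 2))),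
    ← Finset.add_sum_erase (f := fun i => θ (Sum.inr i)) _ (Finset.mem_univ (1 : Fin (n + 2)))]
  have : ∑ x ∈ Finset.univ.erase (1 : Fin (n + 2)),
      -1 * (if x = 1 then 1 + μ else 1) * θ (Sum.inr x) =
      -∑ x ∈ Finset.univ.erase (1 : Fin (n + 2)), θ (Sum.inr x) := by
    rw [← Finset.sum_neg_distrib]
    refine Finset.sum_congr rfl fun x hx => ?_
    rw [if_neg (Finset.ne_of_mem_erase hx)]; ring
  rw [this]; simp; ring

theorem act_A2_inr (n : ℕ) (μ : ℝ) (θ : Param (n + 2)) (i : Fin (n + 2)) :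
    act (A2 (n + 2) μ) θ (Sum.inr i) =
      -(kernelSum θ + (if i = 0 then μ * θ (Sum.inl 0) else 0) +
        (if i = 1 then μ * θ (Sum.inl 1) else 0)) := by
  rw [A2, act_sampleMat_inr, Matrix.mulVec_smul]
  simp only [y2, Pi.smul_apply, shift_b2_apply, b2_apply, kernelSum, smul_eq_mul]
  split_ifs <;> ring

theorem quad_eq_inner {d : ℕ} (A : Matrix (Fin 2 ⊕ Fin d) (Fin 2 ⊕ Fin d) ℝ) (θ : Param d) :
    quad A θ = ∑ j, θ (Sum.inl j) * act A θ (Sum.inl j) +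
      ∑ i, θ (Sum.inr i) * act A θ (Sum.inr i) := by
  simp [quad, act, dotProduct]

theorem quad_A1 (n : ℕ) (θ : Param (n + 2)) :
    quad (A1 (n + 2)) θ = 2 * (kernelSum θ * weightSum θ) := by
  simp only [quad_eq_inner, act_A1_inl, act_A1_inr, ← Finset.sum_mul, Fin.sum_univ_two]
  simp only [kernelSum, weightSum]
  ring

theorem quad_A2 (n : ℕ) (μ : ℝ) (θ : Param (n + 2)) :
    quad (A2 (n + 2) μ) θ = -2 * (kernelSum θ * weightSum θ +
      μ * (θ (Sum.inl 0) * θ (Sum.inr 0) + θ (Sum.inl 1) * θ (Sum.inr 1))) := by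
  simp only [quad_eq_inner, act_A2_inl_zero, act_A2_inl_one, act_A2_inr, Fin.sum_univ_two,
    mul_neg, mul_add, Finset.sum_neg_distrib, Finset.sum_add_distrib, ← Finset.sum_mul, mul_ite,
    mul_zero, Finset.sum_ite_eq', Finset.mem_univ, if_true]
  simp only [kernelSum, weightSum]
  ring

theorem inner_act_sampleMat {d : ℕ} (a : Fin d → ℝ) (θ v : Param d) :
    inner ℝ (act (sampleMat a) θ) v = inner ℝ θ (act (sampleMat a) v) := by
  have hs : (sampleMat a)ᵀ = sampleMat a := by
    simp [sampleMat, Matrix.fromBlocks_transpose]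
  simp only [EuclideanSpace.inner_eq_star_dotProduct, act, star_trivial]
  rw [Matrix.dotProduct_mulVec, ← Matrix.mulVec_transpose, hs, dotProduct_comm]

theorem param_norm_sq {d : ℕ} (θ : Param d) :
    ‖θ‖ ^ 2 = θ (Sum.inl 0) ^ 2 + θ (Sum.inl 1) ^ 2 + ∑ i, θ (Sum.inr i) ^ 2 := by
  simp [EuclideanSpace.real_norm_sq_eq]

theorem kernelSum_add {d : ℕ} (θ ξ : Param d) :
    kernelSum (θ + ξ) = kernelSum θ + kernelSum ξ := by
  simp [kernelSum]; ring

theorem kernelSum_smul {d : ℕ} (c : ℝ) (θ : Param d) :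
    kernelSum (c • θ) = c * kernelSum θ := by
  simp [kernelSum]; ring

theorem weightSum_add {d : ℕ} (θ ξ : Param d) :
    weightSum (θ + ξ) = weightSum θ + weightSum ξ := by
  simp [weightSum, Finset.sum_add_distrib]

theorem weightSum_smul {d : ℕ} (c : ℝ) (θ : Param d) :
    weightSum (c • θ) = c * weightSum θ := by
  simp [weightSum, Finset.mul_sum]

theorem kernelSum_act_A1 (n : ℕ) (θ : Param (n + 2)) :
    kernelSum (act (A1 (n + 2)) θ) = 2 * weightSum θ := by
  rw [kernelSum, act_A1_inl, act_A1_inl]; ring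

theorem weightSum_act_A1 (n : ℕ) (θ : Param (n + 2)) :
    weightSum (act (A1 (n + 2)) θ) = (n + 2) * kernelSum θ := by
  simp only [weightSum, act_A1_inr]; simp

theorem kernelSum_act_A2 (n : ℕ) (μ : ℝ) (θ : Param (n + 2)) :
    kernelSum (act (A2 (n + 2) μ) θ) =
      -(2 * weightSum θ + μ * (θ (Sum.inr 0) + θ (Sum.inr 1))) := by
  rw [kernelSum, act_A2_inl_zero, act_A2_inl_one]; ring

theorem weightSum_act_A2 (n : ℕ) (μ : ℝ) (θ : Param (n + 2)) :
    weightSum (act (A2 (n + 2) μ) θ) = -((n + 2 + μ) * kernelSum θ) := by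
  simp only [weightSum, act_A2_inr, Finset.sum_neg_distrib, Finset.sum_add_distrib]
  simp [kernelSum]; ring

/-- Every eigenvector of `A₂` for the eigenvalue `μ > 0` lies in the kernel of `A₁`. -/
theorem act_A1_eq_zero_of_eigenvector (n : ℕ) {μ : ℝ} (hμ : 0 < μ) {v : Param (n + 2)}
    (hv : act (A2 (n + 2) μ) v = μ • v) : act (A1 (n + 2)) v = 0 := by
  have h1 := congrArg kernelSum hv
  have h2 := congrArg weightSum hv
  have h3 := congrArg (fun w : Param (n + 2) => w (Sum.inr 0) + w (Sum.inr 1)) hv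
  simp only [kernelSum_act_A2, weightSum_act_A2, kernelSum_smul, weightSum_smul,
    act_A2_inr] at h1 h2 h3
  simp only [PiLp.smul_apply, smul_eq_mul, if_true, zero_ne_one, one_ne_zero,
    if_false, add_zero] at h3
  have h4 : kernelSum v = v (Sum.inl 0) + v (Sum.inl 1) := rfl
  have h3' : μ * (v (Sum.inr 0) + v (Sum.inr 1)) = -((2 + μ) * kernelSum v) := by
    rw [h4] at h3 ⊢
    simp at h3
    linarith
  -- The eigenvalue equation closes up on the kernel sum, the weight sum and v₁ + v₂; eliminating
  -- the last two leaves the kernel sum times a positive number.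
  have ha : kernelSum v * (2 * (n + 2 + μ) + 2 * μ) = 0 := by
    linear_combination μ * h1 - 2 * h2 + μ * h3'
  have hpos : (2 * ((n : ℝ) + 2 + μ) + 2 * μ) ≠ 0 := by positivity
  have ha0 : kernelSum v = 0 := (mul_eq_zero.1 ha).resolve_right hpos
  have hX : weightSum v = 0 := by
    rw [ha0] at h2
    have : μ * weightSum v = 0 := by linarith
    exact (mul_eq_zero.1 this).resolve_left hμ.ne'
  ext i
  rcases i with j | i
  · rw [act_A1_inl, hX]; rfl
  · rw [act_A1_inr, ha0]; rfl

/-! ### The potential: scalar inequalities and its growth in one step. -/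

theorem add_le_abs_sub_add {a Y : ℝ} :
    a ^ 2 / 2 + Y ^ 2 ≤ |a ^ 2 / 2 - Y ^ 2| + 3 / 2 * |a * Y| := by
  have h : |a ^ 2 / 2 - Y ^ 2| ^ 2 = (a ^ 2 / 2 - Y ^ 2) ^ 2 := sq_abs _
  have h' : |a * Y| ^ 2 = (a * Y) ^ 2 := sq_abs _
  -- With p = a²/2 and r = Y², (p + r)² = (p - r)² + 2(aY)², and √2 ≤ 3/2.
  refine abs_le_of_sq_le_sq' ?_ (by positivity) |>.2
  nlinarith [mul_nonneg (abs_nonneg (a ^ 2 / 2 - Y ^ 2)) (abs_nonneg (a * Y)), sq_nonneg (a * Y)]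

/-- A step along A₁ contracts a²/2 - Y² by 7/8. The freed quarter of its absolute value, together
with the gain aY ≤ 0, pays for the second-order term. -/
theorem potential_drift_nonpos {a Y : ℝ} (h : a * Y ≤ 0) :
    a * Y + (a ^ 2 / 2 + Y ^ 2) / 8 + 2 * |7 / 8 * (a ^ 2 / 2 - Y ^ 2)| ≤
      2 * |a ^ 2 / 2 - Y ^ 2| := by
  have h1 := add_le_abs_sub_add (a := a) (Y := Y)
  have h2 : |a * Y| = -(a * Y) := abs_of_nonpos h
  rw [abs_mul, abs_of_pos (by norm_num : (0 : ℝ) < 7 / 8)]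
  linarith [abs_nonneg (a ^ 2 / 2 - Y ^ 2), add_le_abs_sub_add (a := a) (Y := Y)]

/-- Dictionary for a step along A₂: m = 1 + μ/d, E = 2ε times `headGap`, n = c₁ - c₂, f = v₁ - v₂, N
= ‖θ‖²; `hQ` says that sample 2 is misclassified. Up to errors of order εN, aY is at most the
first-order decrease Q of the squared norm, so Q absorbs the second-order terms. The constant 1.4
has to stay below 2, because the squared correlation with v grows at relative rate 2ε. -/
theorem potential_drift_le {a Y E n f ε m M N : ℝ} (haY : 0 < a * Y)
    (hQ : 0 ≤ a * (m * Y + E) + 2 * ε * (n * f)) (hm : 1 ≤ m) (hm' : m ≤ 1.05)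
    (hM : M ≤ 1.11) (hE : E ^ 2 ≤ 0.056 * ε * N) (hnf : n ^ 2 + f ^ 2 ≤ 2 * N)
    (hε : 0 ≤ ε) (hε' : ε ≤ 0.02) :
    -(a * (m * Y + E) + 2 * ε * (n * f)) + (m * Y + E) ^ 2 / 8 + M * a ^ 2 / 16 +
        ε ^ 2 * (n ^ 2 + f ^ 2) / 2 +
        2 * |(a ^ 2 / 2 - Y ^ 2) * (1 - m ^ 2 / 8) - a * E / 2 + (2 * m * (Y * E) + E ^ 2) / 8| ≤
      2 * |a ^ 2 / 2 - Y ^ 2| + 1.4 * ε * N := by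
  set D := |a ^ 2 / 2 - Y ^ 2| with hD
  set Q := a * (m * Y + E) + 2 * ε * (n * f) with hQdef
  have hm2 : m ^ 2 ≤ 1.11 := by nlinarith
  have hm1 : 1 ≤ m ^ 2 := by nlinarith
  have hD0 : 0 ≤ D := abs_nonneg _
  have h1 : a ^ 2 / 2 + Y ^ 2 ≤ D + 3 / 2 * (a * Y) := by
    have := add_le_abs_sub_add (a := a) (Y := Y)
    rwa [abs_of_pos haY] at this
  have h2 : |(a ^ 2 / 2 - Y ^ 2) * (1 - m ^ 2 / 8) - a * E / 2 +
      (2 * m * (Y * E) + E ^ 2) / 8| ≤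
      D * (7 / 8) + |a * E| / 2 + (2.1 * |Y * E| + E ^ 2) / 8 := by
    have t1 : |(a ^ 2 / 2 - Y ^ 2) * (1 - m ^ 2 / 8)| ≤ D * (7 / 8) := by
      rw [abs_mul]
      refine mul_le_mul_of_nonneg_left ?_ hD0
      rw [abs_of_nonneg (by linarith)]; linarith
    have t2 : |2 * m * (Y * E) + E ^ 2| ≤ 2.1 * |Y * E| + E ^ 2 := by
      refine (abs_add_le _ _).trans ?_
      rw [abs_mul, abs_of_nonneg (by linarith : 0 ≤ 2 * m), abs_of_nonneg (sq_nonneg E)]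
      nlinarith [abs_nonneg (Y * E)]
    calc _ ≤ |(a ^ 2 / 2 - Y ^ 2) * (1 - m ^ 2 / 8)| + |a * E| / 2 +
          |2 * m * (Y * E) + E ^ 2| / 8 := by
          refine (abs_add_le _ _).trans ?_
          have t3 := abs_sub ((a ^ 2 / 2 - Y ^ 2) * (1 - m ^ 2 / 8)) (a * E / 2)
          have t4 : |a * E / 2| = |a * E| / 2 := by rw [abs_div, abs_two]
          have t5 : |(2 * m * (Y * E) + E ^ 2) / 8| = |2 * m * (Y * E) + E ^ 2| / 8 := by
            rw [abs_div]; norm_num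
          linarith
      _ ≤ _ := by linarith
  have hN : 0 ≤ N := by nlinarith [sq_nonneg n, sq_nonneg f]
  have hnf' : -(n * f) ≤ N := by nlinarith [sq_nonneg (n + f)]
  -- `a Y` is controlled by the quadratic form
  have h3 : a * Y ≤ Q + |a * E| + 2 * ε * N := by
    have e1 : -(a * E) ≤ |a * E| := neg_le_abs _
    have e2 : -(ε * (n * f)) ≤ ε * N := by
      rw [← mul_neg]; exact mul_le_mul_of_nonneg_left hnf' hε
    have e3 : a * Y ≤ m * (a * Y) := le_mul_of_one_le_left haY.le hm
    have e4 : Q = m * (a * Y) + a * E + 2 * (ε * (n * f)) := by rw [hQdef]; ring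
    linarith
  have hYE : (m * Y + E) ^ 2 ≤ 1.11 * Y ^ 2 + 2.1 * |Y * E| + E ^ 2 := by
    have e1 : m ^ 2 * Y ^ 2 ≤ 1.11 * Y ^ 2 := mul_le_mul_of_nonneg_right hm2 (sq_nonneg Y)
    have e2 : 2 * m * (Y * E) ≤ 2.1 * |Y * E| :=
      (mul_le_mul_of_nonneg_left (le_abs_self _) (by linarith)).trans
        (mul_le_mul_of_nonneg_right (by linarith) (abs_nonneg _))
    linarith [show (m * Y + E) ^ 2 = m ^ 2 * Y ^ 2 + 2 * m * (Y * E) + E ^ 2 by ring]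
  have hMa : M * a ^ 2 ≤ 1.11 * a ^ 2 := mul_le_mul_of_nonneg_right hM (sq_nonneg a)
  have hεN : 0 ≤ ε * N := mul_nonneg hε hN
  have hεε : ε ^ 2 * (n ^ 2 + f ^ 2) / 2 ≤ 0.02 * (ε * N) := by
    have : ε ^ 2 * (n ^ 2 + f ^ 2) ≤ ε ^ 2 * (2 * N) := by gcongr
    have : ε * (ε * N) ≤ 0.02 * (ε * N) := mul_le_mul_of_nonneg_right hε' hεN
    linarith
  -- The weights keep the a² and Y² parts within what the contraction of D and the term Q can still
  -- absorb; the remaining multiple of E² costs 0.056 ε N per unit and fits into 1.4 ε N.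
  have amgm1 : |a * E| ≤ 0.04 * a ^ 2 + 6.25 * E ^ 2 := by
    rw [abs_mul]
    nlinarith only [sq_nonneg (0.2 * |a| - 2.5 * |E|), sq_abs a, sq_abs E]
  have amgm2 : |Y * E| ≤ 0.14 * Y ^ 2 + 1.79 * E ^ 2 := by
    rw [abs_mul]
    nlinarith only [sq_nonneg (0.14 * |Y| - 0.5 * |E|), sq_abs Y, sq_abs E]
  linarith [sq_nonneg E, sq_nonneg a, sq_nonneg Y]

/-- The sum of the weights, normalized to be the coordinate along a unit vector. -/
def scaledSum {d : ℕ} (θ : Param d) : ℝ := weightSum θ / √(d : ℝ)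

/-- The quantity `‖θ‖² + |(c₁ + c₂)² - 2 (∑ vᵢ)² / d|`, which controls the norm of the iterates. -/
def potential {d : ℕ} (θ : Param d) : ℝ :=
  ‖θ‖ ^ 2 + 2 * |kernelSum θ ^ 2 / 2 - scaledSum θ ^ 2|

theorem scaledSum_add {d : ℕ} (θ ξ : Param d) :
    scaledSum (θ + ξ) = scaledSum θ + scaledSum ξ := by
  rw [scaledSum, weightSum_add, add_div]; rfl

theorem scaledSum_smul {d : ℕ} (c : ℝ) (θ : Param d) :
    scaledSum (c • θ) = c * scaledSum θ := by
  rw [scaledSum, weightSum_smul, mul_div_assoc]; rfl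

theorem scaledSum_sq_le {d : ℕ} (θ : Param d) : scaledSum θ ^ 2 ≤ ∑ i, θ (Sum.inr i) ^ 2 := by
  have h := sq_sum_le_card_mul_sum_sq (s := Finset.univ) (f := fun i : Fin d => θ (Sum.inr i))
  rw [scaledSum, div_pow, Real.sq_sqrt (Nat.cast_nonneg d)]
  refine div_le_of_le_mul₀ (Nat.cast_nonneg d) (Finset.sum_nonneg fun i _ => sq_nonneg _) ?_
  rw [Finset.card_univ, Fintype.card_fin] at h
  rw [mul_comm]; exact h

theorem kernelSum_sq_add_scaledSum_sq_le {d : ℕ} (θ : Param d) :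
    kernelSum θ ^ 2 / 2 + scaledSum θ ^ 2 ≤ ‖θ‖ ^ 2 := by
  rw [param_norm_sq, kernelSum]
  have := scaledSum_sq_le θ
  nlinarith [sq_nonneg (θ (Sum.inl 0) - θ (Sum.inl 1))]

theorem norm_sq_le_potential {d : ℕ} (θ : Param d) : ‖θ‖ ^ 2 ≤ potential θ := by
  rw [potential]; linarith [abs_nonneg (kernelSum θ ^ 2 / 2 - scaledSum θ ^ 2)]

theorem potential_nonneg {d : ℕ} (θ : Param d) : 0 ≤ potential θ :=
  (sq_nonneg _).trans (norm_sq_le_potential θ)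

theorem norm_le_sqrt_potential {d : ℕ} (θ : Param d) : ‖θ‖ ≤ √(potential θ) :=
  Real.le_sqrt_of_sq_le (norm_sq_le_potential θ)

theorem potential_le {d : ℕ} (θ : Param d) : potential θ ≤ 3 * ‖θ‖ ^ 2 := by
  have h := kernelSum_sq_add_scaledSum_sq_le θ
  have : |kernelSum θ ^ 2 / 2 - scaledSum θ ^ 2| ≤ ‖θ‖ ^ 2 :=
    abs_le.2 ⟨by nlinarith [sq_nonneg (kernelSum θ)], by nlinarith [sq_nonneg (scaledSum θ)]⟩
  rw [potential]; linarith

theorem sqrt_potential_le {d : ℕ} (θ : Param d) : √(potential θ) ≤ 7 / 4 * ‖θ‖ := by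
  refine Real.sqrt_le_iff.2 ⟨by positivity, (potential_le θ).trans ?_⟩
  nlinarith [sq_nonneg ‖θ‖]

/-- The cross term of the indefinite form a²/2 - Y² is bounded by Cauchy–Schwarz, so Φ(θ + ξ) ≤ Φ(θ)
+ 6‖θ‖‖ξ‖ + 3‖ξ‖², and ‖θ‖ ≤ √Φ(θ) completes the square. -/
theorem sqrt_potential_add_le {d : ℕ} (θ ξ : Param d) :
    √(potential (θ + ξ)) ≤ √(potential θ) + 3 * ‖ξ‖ := by
  have hs := Real.sq_sqrt (potential_nonneg θ)
  have hle := norm_le_sqrt_potential θ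
  refine Real.sqrt_le_iff.2 ⟨by positivity, ?_⟩
  have h1 := kernelSum_sq_add_scaledSum_sq_le θ
  have h2 := kernelSum_sq_add_scaledSum_sq_le ξ
  have hn : ‖θ + ξ‖ ^ 2 ≤ (‖θ‖ + ‖ξ‖) ^ 2 := by gcongr; exact norm_add_le _ _
  have hD : |kernelSum (θ + ξ) ^ 2 / 2 - scaledSum (θ + ξ) ^ 2| ≤
      |kernelSum θ ^ 2 / 2 - scaledSum θ ^ 2| + 2 * (‖θ‖ * ‖ξ‖) + ‖ξ‖ ^ 2 := by
    rw [kernelSum_add, scaledSum_add]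
    set a := kernelSum θ
    set b := kernelSum ξ
    set y := scaledSum θ
    set z := scaledSum ξ
    have e1 : |b ^ 2 / 2 - z ^ 2| ≤ ‖ξ‖ ^ 2 := abs_le.2 ⟨by nlinarith [sq_nonneg b],
      by nlinarith [sq_nonneg z]⟩
    have e2 : |a * b - 2 * (y * z)| ≤ 2 * (‖θ‖ * ‖ξ‖) := by
      refine abs_le_of_sq_le_sq ?_ (by positivity)
      have hmul : (a ^ 2 / 2 + y ^ 2) * (b ^ 2 / 2 + z ^ 2) ≤ ‖θ‖ ^ 2 * ‖ξ‖ ^ 2 :=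
        mul_le_mul h1 h2 (by positivity) (by positivity)
      nlinarith [sq_nonneg (a * z + b * y)]
    calc _ = |(a ^ 2 / 2 - y ^ 2) + (a * b - 2 * (y * z)) + (b ^ 2 / 2 - z ^ 2)| := by
          congr 1; ring
      _ ≤ _ := (abs_add_three _ _ _).trans (by linarith)
  have hmul : ‖θ‖ * ‖ξ‖ ≤ √(potential θ) * ‖ξ‖ :=
    mul_le_mul_of_nonneg_right hle (norm_nonneg ξ)
  have hdef : potential (θ + ξ) =
    ‖θ + ξ‖ ^ 2 + 2 * |kernelSum (θ + ξ) ^ 2 / 2 - scaledSum (θ + ξ) ^ 2| := rfl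
  have hdef' : potential θ = ‖θ‖ ^ 2 + 2 * |kernelSum θ ^ 2 / 2 - scaledSum θ ^ 2| := rfl
  nlinarith [sq_nonneg ‖ξ‖]

theorem weightSum_eq (n : ℕ) (θ : Param (n + 2)) :
    weightSum θ = √(n + 2 : ℝ) * scaledSum θ := by
  have : (0 : ℝ) < √(n + 2 : ℝ) := by positivity
  rw [scaledSum]; push_cast; field_simp

theorem stepSize_eq (n : ℕ) : stepSize (n + 2) = 1 / (4 * √(n + 2 : ℝ)) := by
  rw [stepSize]; push_cast; rfl

theorem kernelSum_step_A1 (n : ℕ) (θ : Param (n + 2)) :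
    kernelSum (θ + stepSize (n + 2) • act (A1 (n + 2)) θ) = kernelSum θ + scaledSum θ / 2 := by
  have : (0 : ℝ) < √(n + 2 : ℝ) := by positivity
  rw [kernelSum_add, kernelSum_smul, kernelSum_act_A1, weightSum_eq, stepSize_eq]
  field_simp; ring

theorem scaledSum_step_A1 (n : ℕ) (θ : Param (n + 2)) :
    scaledSum (θ + stepSize (n + 2) • act (A1 (n + 2)) θ) = scaledSum θ + kernelSum θ / 4 := by
  have h : (0 : ℝ) < √(n + 2 : ℝ) := by positivity
  have h2 : √(n + 2 : ℝ) ^ 2 = n + 2 := Real.sq_sqrt (by positivity)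
  rw [scaledSum_add, scaledSum_smul, scaledSum, scaledSum, weightSum_act_A1, stepSize_eq]
  push_cast
  generalize √(n + 2 : ℝ) = s at *
  rw [← h2]
  field_simp

theorem norm_sq_step_A1 (n : ℕ) (θ : Param (n + 2)) :
    ‖θ + stepSize (n + 2) • act (A1 (n + 2)) θ‖ ^ 2 =
      ‖θ‖ ^ 2 + kernelSum θ * scaledSum θ + (kernelSum θ ^ 2 / 2 + scaledSum θ ^ 2) / 8 := by
  have h : (0 : ℝ) < √(n + 2 : ℝ) := by positivity
  have h2 : √(n + 2 : ℝ) ^ 2 = n + 2 := Real.sq_sqrt (by positivity)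
  have hs : ∑ i, (θ (Sum.inr i) + stepSize (n + 2) * kernelSum θ) ^ 2 =
      ∑ i, θ (Sum.inr i) ^ 2 + 2 * stepSize (n + 2) * kernelSum θ * weightSum θ +
        (n + 2) * (stepSize (n + 2) * kernelSum θ) ^ 2 := by
    simp only [add_sq, Finset.sum_add_distrib, weightSum, Finset.mul_sum]
    simp
    refine Finset.sum_congr rfl fun i _ => by ring
  rw [param_norm_sq, param_norm_sq]
  simp only [PiLp.add_apply, PiLp.smul_apply, smul_eq_mul, act_A1_inl, act_A1_inr]
  rw [hs, weightSum_eq, stepSize_eq]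
  have hk : kernelSum θ = θ (Sum.inl 0) + θ (Sum.inl 1) := rfl
  clear hs
  generalize √(n + 2 : ℝ) = s at *
  rw [← h2]
  rw [hk]
  field_simp
  ring

theorem potential_step_A1_le (n : ℕ) (θ : Param (n + 2)) (hq : quad (A1 (n + 2)) θ ≤ 0) :
    potential (θ + stepSize (n + 2) • act (A1 (n + 2)) θ) ≤ potential θ := by
  have h : (0 : ℝ) < √(n + 2 : ℝ) := by positivity
  have haY : kernelSum θ * scaledSum θ ≤ 0 := by
    rw [quad_A1, weightSum_eq] at hq
    by_contra! hc
    nlinarith [mul_pos h hc]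
  rw [potential, norm_sq_step_A1, kernelSum_step_A1, scaledSum_step_A1]
  have := potential_drift_nonpos haY
  rw [show (kernelSum θ + scaledSum θ / 2) ^ 2 / 2 - (scaledSum θ + kernelSum θ / 4) ^ 2 =
    7 / 8 * (kernelSum θ ^ 2 / 2 - scaledSum θ ^ 2) by ring, potential]
  linarith

/-- The component of `v₁ + v₂` orthogonal to the all-ones direction. -/
def headGap {n : ℕ} (θ : Param (n + 2)) : ℝ :=
  θ (Sum.inr 0) + θ (Sum.inr 1) - 2 * scaledSum θ / √(n + 2 : ℝ)

/-- Cauchy–Schwarz against the projection of e₁ + e₂ orthogonal to the all-ones vector, whose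
squared norm is 2 - 4/d = 2n/(n + 2). -/
theorem headGap_sq_le (n : ℕ) (θ : Param (n + 2)) :
    headGap θ ^ 2 ≤ 2 * n / (n + 2) * ‖θ‖ ^ 2 := by
  have h : (0 : ℝ) < √(n + 2 : ℝ) := by positivity
  have h2 : √(n + 2 : ℝ) ^ 2 = n + 2 := Real.sq_sqrt (by positivity)
  have hn : (0 : ℝ) < n + 2 := by positivity
  have hX : scaledSum θ / √(n + 2 : ℝ) = weightSum θ / (n + 2) := by
    rw [weightSum_eq]
    generalize √(n + 2 : ℝ) = s at *
    rw [← h2]; field_simp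
  have hgap : headGap θ = θ (Sum.inr 0) + θ (Sum.inr 1) - 2 * (weightSum θ / (n + 2)) := by
    rw [headGap, mul_div_assoc, hX]
  set R := ∑ i : Fin n, θ (Sum.inr i.succ.succ) with hR
  set S := ∑ i : Fin n, θ (Sum.inr i.succ.succ) ^ 2 with hS
  have hRS : R ^ 2 ≤ n * S := by
    have := sq_sum_le_card_mul_sum_sq (s := Finset.univ)
      (f := fun i : Fin n => θ (Sum.inr i.succ.succ))
    simpa using this
  have hw : weightSum θ = θ (Sum.inr 0) + θ (Sum.inr 1) + R := by
    rw [weightSum, Fin.sum_univ_succ, Fin.sum_univ_succ, hR]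
    rw [Fin.succ_zero_eq_one]; ring
  have hnorm : θ (Sum.inr 0) ^ 2 + θ (Sum.inr 1) ^ 2 + S ≤ ‖θ‖ ^ 2 := by
    rw [param_norm_sq, Fin.sum_univ_succ, Fin.sum_univ_succ, hS]
    rw [Fin.succ_zero_eq_one]
    nlinarith [sq_nonneg (θ (Sum.inl 0)), sq_nonneg (θ (Sum.inl 1))]
  set e := θ (Sum.inr 0) + θ (Sum.inr 1) with he
  have he2 : e ^ 2 ≤ 2 * (θ (Sum.inr 0) ^ 2 + θ (Sum.inr 1) ^ 2) := by
    nlinarith [sq_nonneg (θ (Sum.inr 0) - θ (Sum.inr 1))]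
  have hform : headGap θ = (n * e - 2 * R) / (n + 2) := by
    rw [hgap, hw]; field_simp; ring
  have hkey : (n * e - 2 * R) ^ 2 ≤ 2 * n * (n + 2) * ‖θ‖ ^ 2 := by
    have hn0 : (0 : ℝ) ≤ n := Nat.cast_nonneg n
    have k1 : (n * e - 2 * R) ^ 2 ≤ n * (n + 2) * e ^ 2 + 2 * (n + 2) * R ^ 2 := by
      nlinarith [mul_nonneg hn0 (sq_nonneg (e + R))]
    have k2 : (n + 2) * R ^ 2 ≤ (n + 2) * (n * S) := mul_le_mul_of_nonneg_left hRS hn.le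
    have k3 := mul_le_mul_of_nonneg_left he2 (mul_nonneg hn0 hn.le)
    have k4 := mul_le_mul_of_nonneg_left hnorm (mul_nonneg hn0 hn.le)
    linarith
  rw [hform, div_pow, div_le_iff₀ (by positivity)]
  refine hkey.trans (le_of_eq ?_)
  field_simp

/-- The relative growth `γ μ = μ / (4 √d)` of the correlation with `v` in a step along `A₂`. -/
def growthRate (d : ℕ) (μ : ℝ) : ℝ := stepSize d * μ

theorem growthRate_eq (n : ℕ) (μ : ℝ) : growthRate (n + 2) μ = μ / (4 * √(n + 2 : ℝ)) := by
  rw [growthRate, stepSize_eq]; ring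

theorem growthRate_pos (n : ℕ) {μ : ℝ} (hμ : 0 < μ) : 0 < growthRate (n + 2) μ := by
  rw [growthRate_eq]; positivity

theorem one_lt_sqrt_add_two (n : ℕ) : 1.4 < √(n + 2 : ℝ) :=
  Real.lt_sqrt_of_sq_lt (by norm_num; linarith [(Nat.cast_nonneg n : (0 : ℝ) ≤ n)])

theorem growthRate_le (n : ℕ) {μ : ℝ} (hμ' : μ ≤ 1 / 10) :
    growthRate (n + 2) μ ≤ 0.02 := by
  have h := one_lt_sqrt_add_two n
  rw [growthRate_eq, div_le_iff₀ (by linarith)]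
  linarith

theorem kernelSum_step_A2 (n : ℕ) (μ : ℝ) (θ : Param (n + 2)) :
    kernelSum (θ + stepSize (n + 2) • act (A2 (n + 2) μ) θ) = kernelSum θ -
      ((1 + μ / (n + 2)) * scaledSum θ + 2 * growthRate (n + 2) μ * headGap θ) / 2 := by
  have h : (0 : ℝ) < √(n + 2 : ℝ) := by positivity
  have h2 : √(n + 2 : ℝ) ^ 2 = n + 2 := Real.sq_sqrt (by positivity)
  rw [kernelSum_add, kernelSum_smul, kernelSum_act_A2, weightSum_eq, stepSize_eq, growthRate_eq,
    headGap]
  generalize √(n + 2 : ℝ) = s at *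
  rw [← h2]
  field_simp
  ring

theorem scaledSum_step_A2 (n : ℕ) (μ : ℝ) (θ : Param (n + 2)) :
    scaledSum (θ + stepSize (n + 2) • act (A2 (n + 2) μ) θ) =
      scaledSum θ - (1 + μ / (n + 2)) * kernelSum θ / 4 := by
  have h : (0 : ℝ) < √(n + 2 : ℝ) := by positivity
  have h2 : √(n + 2 : ℝ) ^ 2 = n + 2 := Real.sq_sqrt (by positivity)
  rw [scaledSum_add, scaledSum_smul, scaledSum, scaledSum, weightSum_act_A2, stepSize_eq]
  push_cast
  generalize √(n + 2 : ℝ) = s at *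
  rw [← h2]
  field_simp
  ring

theorem quad_A2_eq (n : ℕ) (μ : ℝ) (θ : Param (n + 2)) :
    quad (A2 (n + 2) μ) θ = -2 * √(n + 2 : ℝ) * (kernelSum θ *
      ((1 + μ / (n + 2)) * scaledSum θ + 2 * growthRate (n + 2) μ * headGap θ) +
      2 * growthRate (n + 2) μ * ((θ (Sum.inl 0) - θ (Sum.inl 1)) *
        (θ (Sum.inr 0) - θ (Sum.inr 1)))) := by
  have h : (0 : ℝ) < √(n + 2 : ℝ) := by positivity
  have h2 : √(n + 2 : ℝ) ^ 2 = n + 2 := Real.sq_sqrt (by positivity)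
  have hk : kernelSum θ = θ (Sum.inl 0) + θ (Sum.inl 1) := rfl
  rw [quad_A2, weightSum_eq, growthRate_eq, headGap, hk]
  generalize √(n + 2 : ℝ) = s at *
  rw [← h2]
  field_simp
  ring

theorem norm_sq_step_A2 (n : ℕ) (μ : ℝ) (θ : Param (n + 2)) :
    ‖θ + stepSize (n + 2) • act (A2 (n + 2) μ) θ‖ ^ 2 = ‖θ‖ ^ 2 -
      (kernelSum θ *
        ((1 + μ / (n + 2)) * scaledSum θ + 2 * growthRate (n + 2) μ * headGap θ) +
        2 * growthRate (n + 2) μ * ((θ (Sum.inl 0) - θ (Sum.inl 1)) *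
          (θ (Sum.inr 0) - θ (Sum.inr 1)))) +
      ((1 + μ / (n + 2)) * scaledSum θ + 2 * growthRate (n + 2) μ * headGap θ) ^ 2 / 8 +
      (1 + 2 * μ / (n + 2) + μ ^ 2 / (2 * (n + 2))) * kernelSum θ ^ 2 / 16 +
      growthRate (n + 2) μ ^ 2 * ((θ (Sum.inl 0) - θ (Sum.inl 1)) ^ 2 +
        (θ (Sum.inr 0) - θ (Sum.inr 1)) ^ 2) / 2 := by
  have h : (0 : ℝ) < √(n + 2 : ℝ) := by positivity
  have h2 : √(n + 2 : ℝ) ^ 2 = n + 2 := Real.sq_sqrt (by positivity)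
  have hn : (n : ℝ) = √(n + 2 : ℝ) ^ 2 - 2 := by linarith
  have hrest : ∀ c : ℝ, ∑ i : Fin n, (θ (Sum.inr i.succ.succ) + c) ^ 2 =
      ∑ i : Fin n, θ (Sum.inr i.succ.succ) ^ 2 +
        2 * c * ∑ i : Fin n, θ (Sum.inr i.succ.succ) + n * c ^ 2 := by
    intro c
    simp only [add_sq, Finset.sum_add_distrib, Finset.mul_sum]
    simp
    refine Finset.sum_congr rfl fun i _ => by ring
  have hw := weightSum_eq n θ
  rw [weightSum, Fin.sum_univ_succ, Fin.sum_univ_succ, Fin.succ_zero_eq_one] at hw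
  have hk : kernelSum θ = θ (Sum.inl 0) + θ (Sum.inl 1) := rfl
  rw [param_norm_sq, param_norm_sq, Fin.sum_univ_succ, Fin.sum_univ_succ,
    Fin.sum_univ_succ (fun i => θ (Sum.inr i) ^ 2), Fin.sum_univ_succ (fun i : Fin (n + 1) =>
      θ (Sum.inr i.succ) ^ 2), Fin.succ_zero_eq_one]
  simp only [PiLp.add_apply, PiLp.smul_apply, smul_eq_mul, act_A2_inl_zero, act_A2_inl_one,
    act_A2_inr, zero_ne_one, one_ne_zero, if_true, if_false, Fin.succ_ne_zero, add_zero]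
  have hne : ∀ i : Fin n, ¬ (i.succ.succ : Fin (n + 2)) = 1 := fun i hi => by
    have := congrArg Fin.val hi; simp at this
  simp only [hne, if_false, add_zero, hrest]
  rw [weightSum_eq, hk, growthRate_eq, headGap, stepSize_eq]
  have hR : ∑ i : Fin n, θ (Sum.inr i.succ.succ) =
      √(n + 2 : ℝ) * scaledSum θ - θ (Sum.inr 0) - θ (Sum.inr 1) := by linarith
  rw [hR]
  clear hR hw hrest hne hk
  generalize √(n + 2 : ℝ) = s at *
  rw [← h2, hn]
  field_simp
  ring

theorem growthRate_headGap_sq_le (n : ℕ) {μ : ℝ} (hμ : 0 < μ) (hμ' : μ ≤ 1 / 10)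
    (θ : Param (n + 2)) :
    (2 * growthRate (n + 2) μ * headGap θ) ^ 2 ≤ 0.056 * growthRate (n + 2) μ * ‖θ‖ ^ 2 := by
  have h : (0 : ℝ) < √(n + 2 : ℝ) := by positivity
  have h2 : √(n + 2 : ℝ) ^ 2 = n + 2 := Real.sq_sqrt (by positivity)
  have hn : (n : ℝ) = √(n + 2 : ℝ) ^ 2 - 2 := by linarith
  have hε := growthRate_pos n hμ
  have hc : 8 * growthRate (n + 2) μ * n / (n + 2) ≤ 0.056 := by
    rw [growthRate_eq]
    have hn0 : (0 : ℝ) ≤ n := Nat.cast_nonneg n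
    generalize √(n + 2 : ℝ) = s at *
    have hcube : (n : ℝ) ≤ 0.28 * s ^ 3 := by
      rw [hn]
      -- On s > 0 the cubic 0.28 s³ - s² + 2 is minimal near s = 2.38, hence the double root in the
      -- hint. The bound 0.056 is 2 · (1/10) · 0.28.
      nlinarith only [mul_nonneg (sq_nonneg (s - 2.38)) (by linarith : 0 ≤ s + 1.19), h]
    rw [← h2, div_le_iff₀ (by positivity)]
    have : 8 * (μ / (4 * s)) * n = 2 * μ * n / s := by field_simp; ring
    rw [this, div_le_iff₀ h]
    have : μ * n ≤ 1 / 10 * (0.28 * s ^ 3) := mul_le_mul hμ' hcube hn0 (by norm_num)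
    nlinarith only [this]
  have hg := headGap_sq_le n θ
  calc (2 * growthRate (n + 2) μ * headGap θ) ^ 2
      = 4 * growthRate (n + 2) μ ^ 2 * headGap θ ^ 2 := by ring
    _ ≤ 4 * growthRate (n + 2) μ ^ 2 * (2 * n / (n + 2) * ‖θ‖ ^ 2) := by gcongr
    _ = (8 * growthRate (n + 2) μ * n / (n + 2)) * growthRate (n + 2) μ * ‖θ‖ ^ 2 := by ring
    _ ≤ _ := by gcongr

/-- The factor 3/4 is strictly below 1, the corresponding factor for the correlation with v in
`inner_step_A2`; this gap bounds the number of steps along A₂. -/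
theorem potential_step_A2_le (n : ℕ) {μ : ℝ} (hμ : 0 < μ) (hμ' : μ ≤ 1 / 10)
    (θ : Param (n + 2)) (hq₁ : 0 < quad (A1 (n + 2)) θ) (hq₂ : quad (A2 (n + 2) μ) θ ≤ 0) :
    potential (θ + stepSize (n + 2) • act (A2 (n + 2) μ) θ) ≤
      (1 + 3 / 4 * growthRate (n + 2) μ) ^ 2 * potential θ := by
  have h : (0 : ℝ) < √(n + 2 : ℝ) := by positivity
  have hn2 : (2 : ℝ) ≤ n + 2 := by linarith [(Nat.cast_nonneg n : (0 : ℝ) ≤ n)]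
  have hε := growthRate_pos n hμ
  have hμn : μ / (n + 2) ≤ 0.05 := by
    rw [div_le_iff₀ (by linarith)]; linarith
  have hμn0 : 0 ≤ μ / (n + 2) := by positivity
  have haY : 0 < kernelSum θ * scaledSum θ := by
    rw [quad_A1, weightSum_eq] at hq₁
    refine pos_of_mul_pos_right (a := 2 * √(n + 2 : ℝ)) ?_ (by positivity)
    linarith
  have hQ : 0 ≤ kernelSum θ *
      ((1 + μ / (n + 2)) * scaledSum θ + 2 * growthRate (n + 2) μ * headGap θ) +
      2 * growthRate (n + 2) μ * ((θ (Sum.inl 0) - θ (Sum.inl 1)) *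
        (θ (Sum.inr 0) - θ (Sum.inr 1))) := by
    rw [quad_A2_eq] at hq₂
    refine nonneg_of_mul_nonneg_right (a := 2 * √(n + 2 : ℝ)) ?_ (by positivity)
    linarith
  have hM : 1 + 2 * μ / (n + 2) + μ ^ 2 / (2 * (n + 2)) ≤ 1.11 := by
    have e : 1 + 2 * μ / (n + 2) + μ ^ 2 / (2 * (n + 2)) =
      1 + 2 * (μ / (n + 2)) + μ / 2 * (μ / (n + 2)) := by field_simp
    rw [e]
    have : μ / 2 * (μ / (n + 2)) ≤ 0.05 * 0.05 :=
      mul_le_mul (by linarith) hμn hμn0 (by norm_num)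
    linarith
  have hnf : (θ (Sum.inl 0) - θ (Sum.inl 1)) ^ 2 + (θ (Sum.inr 0) - θ (Sum.inr 1)) ^ 2 ≤
      2 * ‖θ‖ ^ 2 := by
    have hS : 0 ≤ ∑ i : Fin n, θ (Sum.inr i.succ.succ) ^ 2 :=
      Finset.sum_nonneg fun i _ => sq_nonneg _
    rw [param_norm_sq, Fin.sum_univ_succ, Fin.sum_univ_succ, Fin.succ_zero_eq_one]
    linarith [sq_nonneg (θ (Sum.inl 0) + θ (Sum.inl 1)),
      sq_nonneg (θ (Sum.inr 0) + θ (Sum.inr 1))]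
  have key := potential_drift_le haY hQ (by linarith) (by linarith) hM
    (growthRate_headGap_sq_le n hμ hμ' θ) hnf hε.le (growthRate_le n hμ')
  have hΦ : growthRate (n + 2) μ * ‖θ‖ ^ 2 ≤ growthRate (n + 2) μ * potential θ :=
    mul_le_mul_of_nonneg_left (norm_sq_le_potential θ) hε.le
  have hΦ0 : 0 ≤ growthRate (n + 2) μ * potential θ := mul_nonneg hε.le (potential_nonneg θ)
  have hexp : (1 + 3 / 2 * growthRate (n + 2) μ) * potential θ ≤
      (1 + 3 / 4 * growthRate (n + 2) μ) ^ 2 * potential θ :=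
    mul_le_mul_of_nonneg_right (by nlinarith) (potential_nonneg θ)
  refine le_trans ?_ hexp
  rw [potential, norm_sq_step_A2, kernelSum_step_A2, scaledSum_step_A2]
  have hdef : potential θ = ‖θ‖ ^ 2 + 2 * |kernelSum θ ^ 2 / 2 - scaledSum θ ^ 2| := rfl
  rw [show ∀ a Y E m : ℝ, (a - (m * Y + E) / 2) ^ 2 / 2 - (Y - m * a / 4) ^ 2 =
    (a ^ 2 / 2 - Y ^ 2) * (1 - m ^ 2 / 8) - a * E / 2 + (2 * m * (Y * E) + E ^ 2) / 8 from
    fun a Y E m => by ring]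
  linarith

/-! ### Growth of the correlation with v and of the escape coordinate. -/

theorem inner_step_A1 (n : ℕ) {μ : ℝ} (hμ : 0 < μ) {v : Param (n + 2)}
    (hv : act (A2 (n + 2) μ) v = μ • v) (θ : Param (n + 2)) :
    inner ℝ (θ + stepSize (n + 2) • act (A1 (n + 2)) θ) v = inner ℝ θ v := by
  have h : inner ℝ (act (A1 (n + 2)) θ) v = inner ℝ θ (act (A1 (n + 2)) v) :=
    inner_act_sampleMat _ _ _
  rw [inner_add_left, real_inner_smul_left, h, act_A1_eq_zero_of_eigenvector n hμ hv,
    inner_zero_right, mul_zero, add_zero]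

theorem inner_step_A2 (n : ℕ) {μ : ℝ} {v : Param (n + 2)}
    (hv : act (A2 (n + 2) μ) v = μ • v) (θ : Param (n + 2)) :
    inner ℝ (θ + stepSize (n + 2) • act (A2 (n + 2) μ) θ) v =
      (1 + growthRate (n + 2) μ) * inner ℝ θ v := by
  have h : inner ℝ (act (A2 (n + 2) μ) θ) v = inner ℝ θ (act (A2 (n + 2) μ) v) :=
    inner_act_sampleMat _ _ _
  rw [inner_add_left, real_inner_smul_left, h, hv, real_inner_smul_right, growthRate]
  ring

/-- The expanding direction of a step along `A₁`, normalized to have norm `2`. -/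
def escapeVec (d : ℕ) : Param d :=
  WithLp.toLp 2 (Sum.elim (fun _ => 1) fun _ => √2 / √(d : ℝ))

/-- The coordinate that is expanded by the steps along `A₁`. -/
def escape {d : ℕ} (θ : Param d) : ℝ := inner ℝ (escapeVec d) θ

theorem escape_eq {d : ℕ} (θ : Param d) : escape θ = kernelSum θ + √2 * scaledSum θ := by
  simp only [escape, escapeVec, PiLp.inner_apply, Fintype.sum_sum_type, Sum.elim_inl, Sum.elim_inr,
    Fin.sum_univ_two, kernelSum, scaledSum, weightSum, Finset.sum_div, Finset.mul_sum]
  simp only [RCLike.inner_apply, conj_trivial, mul_one]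
  congr 1
  refine Finset.sum_congr rfl fun i _ => by ring

theorem norm_sq_escapeVec (n : ℕ) : ‖escapeVec (n + 2)‖ ^ 2 = 4 := by
  have h2 : √(n + 2 : ℝ) ^ 2 = n + 2 := Real.sq_sqrt (by positivity)
  have hn : (n + 2 : ℝ) ≠ 0 := by positivity
  rw [param_norm_sq]
  simp [escapeVec, div_pow, h2]
  field_simp
  norm_num

theorem escape_add {d : ℕ} (θ ξ : Param d) : escape (θ + ξ) = escape θ + escape ξ :=
  inner_add_right _ _ _

/-- `escapeVec` is an eigenvector of A₁ for the eigenvalue √(2d), and γ√(2d) = √2/4. -/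
theorem escape_step_A1 (n : ℕ) (θ : Param (n + 2)) :
    escape (θ + stepSize (n + 2) • act (A1 (n + 2)) θ) = (1 + √2 / 4) * escape θ := by
  rw [escape_eq, escape_eq, kernelSum_step_A1, scaledSum_step_A1]
  have : √2 ^ 2 = (2 : ℝ) := Real.sq_sqrt (by norm_num)
  linear_combination (-scaledSum θ / 4) * this

/-- If aY ≤ 0, then (a + √2 Y)² ≤ a² + 2Y² ≤ 2‖θ‖², so the escape coordinate is below twice the
norm. -/
theorem quad_A1_pos_of_escape (n : ℕ) {θ : Param (n + 2)} (h : 2 * ‖θ‖ < |escape θ|) :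
    0 < quad (A1 (n + 2)) θ := by
  have hs : (0 : ℝ) < √(n + 2 : ℝ) := by positivity
  rw [quad_A1, weightSum_eq]
  by_contra! hc
  have haY : kernelSum θ * scaledSum θ ≤ 0 := by
    by_contra! hc'
    nlinarith [mul_pos hs hc']
  have h2 : √2 ^ 2 = (2 : ℝ) := Real.sq_sqrt (by norm_num)
  have hsq : (2 * ‖θ‖) ^ 2 < escape θ ^ 2 := by
    rw [← sq_abs (escape θ)]; gcongr
  have hN := kernelSum_sq_add_scaledSum_sq_le θ
  have hneg : √2 * (kernelSum θ * scaledSum θ) ≤ 0 :=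
    mul_nonpos_of_nonneg_of_nonpos (Real.sqrt_nonneg _) haY
  have hexp : escape θ ^ 2 = kernelSum θ ^ 2 + 2 * scaledSum θ ^ 2 +
      2 * (√2 * (kernelSum θ * scaledSum θ)) := by
    rw [escape_eq]; linear_combination (scaledSum θ ^ 2) * h2
  nlinarith [sq_nonneg ‖θ‖]

/-- For small ε, (1 + 3ε/4)^5 ≤ (1 + ε)^4, since 15/4 < 4 to first order. Raising the hypothesis to
the fourth power then leaves one spare factor (1 + 3ε/4)^N. -/
theorem growth_comparison {ε F G : ℝ} (hε : 0 < ε) (hε' : ε ≤ 0.02) (hG : 0 < G) (hF : 0 < F)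
    {N : ℕ} (h : (1 + ε) ^ N * G ≤ (1 + 3 / 4 * ε) ^ N * F) :
    (1 + 3 / 4 * ε) ^ N ≤ (F / G) ^ 4 ∧ (1 + ε) ^ N ≤ (F / G) ^ 5 := by
  set c := 1 + 3 / 4 * ε with hc
  have hc0 : 0 < c := by positivity
  have hce : c ^ 5 ≤ (1 + ε) ^ 4 := by
    have e2 : ε ^ 2 ≤ 0.02 * ε := by nlinarith
    have e3 : ε ^ 3 ≤ 0.02 * ε ^ 2 := by nlinarith [sq_nonneg ε]
    have e4 : ε ^ 4 ≤ 0.02 * ε ^ 3 := by nlinarith [pow_pos hε 3]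
    have e5 : ε ^ 5 ≤ 0.02 * ε ^ 4 := by nlinarith [pow_pos hε 4]
    have : (1 + ε) ^ 4 - c ^ 5 = 1 / 4 * ε + 3 / 8 * ε ^ 2 - 7 / 32 * ε ^ 3 - 149 / 256 * ε ^ 4
      - 243 / 1024 * ε ^ 5 := by rw [hc]; ring
    have := pow_pos hε 2
    have := pow_pos hε 3
    have := pow_pos hε 4
    linarith
  have h1 : (1 + ε) ^ N ≤ c ^ N * (F / G) := by
    rw [← mul_div_assoc, le_div_iff₀ hG]; exact h
  have h2 : c ^ N ≤ (F / G) ^ 4 := by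
    have hcN : 0 < c ^ N := by positivity
    have : c ^ N * (c ^ N) ^ 4 ≤ (F / G) ^ 4 * (c ^ N) ^ 4 := by
      calc c ^ N * (c ^ N) ^ 4 = (c ^ 5) ^ N := by rw [← pow_mul, ← pow_mul, ← pow_add]; ring_nf
        _ ≤ ((1 + ε) ^ 4) ^ N := by gcongr
        _ = ((1 + ε) ^ N) ^ 4 := by rw [← pow_mul, ← pow_mul, mul_comm]
        _ ≤ (c ^ N * (F / G)) ^ 4 := by gcongr
        _ = _ := by ring
    exact le_of_mul_le_mul_right this (by positivity)
  refine ⟨h2, h1.trans ?_⟩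
  calc c ^ N * (F / G) ≤ (F / G) ^ 4 * (F / G) := by gcongr
    _ = _ := by ring

/-! ### Deterministic analysis of a trajectory with given noise. -/

section Trajectory

variable (n : ℕ) (μ : ℝ) (θ₀ : Param (n + 2)) (ξ : ℕ → Param (n + 2))

/-- The iterates for the step size `1 / (4 √d)`. -/
abbrev orbit (t : ℕ) : Param (n + 2) := iterates (n + 2) μ (stepSize (n + 2)) θ₀ ξ t

/-- The number of steps along `A₂` among the first `t` steps. -/
def updateCount (t : ℕ) : ℕ :=
  ((Finset.range t).filter fun s => 0 < quad (A1 (n + 2)) (orbit n μ θ₀ ξ s)).card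

variable {n μ θ₀ ξ}

theorem orbit_succ_of_nonpos {t : ℕ} (h : quad (A1 (n + 2)) (orbit n μ θ₀ ξ t) ≤ 0) :
    orbit n μ θ₀ ξ (t + 1) = orbit n μ θ₀ ξ t +
      stepSize (n + 2) • act (A1 (n + 2)) (orbit n μ θ₀ ξ t) + ξ t := by
  change step _ _ _ _ _ = _
  rw [step, if_pos h]

theorem quad_A2_nonpos {θ : Param (n + 2)} (hsep : ¬ IsSeparator (n + 2) μ θ)
    (h : 0 < quad (A1 (n + 2)) θ) : quad (A2 (n + 2) μ) θ ≤ 0 := by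
  rw [isSeparator_iff] at hsep
  exact not_lt.1 fun h' => hsep ⟨h, h'⟩

theorem orbit_succ_of_pos {t : ℕ} (hsep : ¬ IsSeparator (n + 2) μ (orbit n μ θ₀ ξ t))
    (h : 0 < quad (A1 (n + 2)) (orbit n μ θ₀ ξ t)) :
    orbit n μ θ₀ ξ (t + 1) = orbit n μ θ₀ ξ t +
      stepSize (n + 2) • act (A2 (n + 2) μ) (orbit n μ θ₀ ξ t) + ξ t := by
  change step _ _ _ _ _ = _
  rw [step, if_neg (not_le.2 h), if_pos (quad_A2_nonpos hsep h)]

theorem updateCount_succ_of_nonpos {t : ℕ} (h : quad (A1 (n + 2)) (orbit n μ θ₀ ξ t) ≤ 0) :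
    updateCount n μ θ₀ ξ (t + 1) = updateCount n μ θ₀ ξ t := by
  rw [updateCount, Finset.range_add_one, Finset.filter_insert, if_neg (not_lt.2 h)]; rfl

theorem updateCount_succ_of_pos {t : ℕ} (h : 0 < quad (A1 (n + 2)) (orbit n μ θ₀ ξ t)) :
    updateCount n μ θ₀ ξ (t + 1) = updateCount n μ θ₀ ξ t + 1 := by
  rw [updateCount, Finset.range_add_one, Finset.filter_insert, if_pos h,
    Finset.card_insert_of_notMem (by simp)]; rfl

theorem updateCount_mono : Monotone (updateCount n μ θ₀ ξ) := fun _ _ h =>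
  Finset.card_le_card (Finset.filter_subset_filter _ (Finset.range_mono h))

/-- Each noise vector adds at most 3R to √Φ. Charging it with the whole growth factor, which is at
least 1, keeps the bound in product form. -/
theorem sqrt_potential_orbit_le (hμ : 0 < μ) (hμ' : μ ≤ 1 / 10) {R : ℝ} {T : ℕ}
    (hξ : ∀ t < T, ‖ξ t‖ ≤ R)
    (hsep : ∀ t < T, ¬ IsSeparator (n + 2) μ (orbit n μ θ₀ ξ t)) (t : ℕ) (ht : t ≤ T) :
    √(potential (orbit n μ θ₀ ξ t)) ≤
      (1 + 3 / 4 * growthRate (n + 2) μ) ^ updateCount n μ θ₀ ξ t *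
        (√(potential θ₀) + t * (3 * R)) := by
  have hε := growthRate_pos n hμ
  induction t with
  | zero => simp [updateCount, iterates]
  | succ t ih =>
    have ih := ih (by omega)
    have hR := hξ t (by omega)
    have hR0 : 0 ≤ R := (norm_nonneg _).trans hR
    have hpow : 1 ≤ (1 + 3 / 4 * growthRate (n + 2) μ) ^ updateCount n μ θ₀ ξ t :=
      one_le_pow₀ (by linarith)
    by_cases hq : quad (A1 (n + 2)) (orbit n μ θ₀ ξ t) ≤ 0
    · rw [orbit_succ_of_nonpos hq, updateCount_succ_of_nonpos hq]
      have h1 := sqrt_potential_add_le (orbit n μ θ₀ ξ t +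
        stepSize (n + 2) • act (A1 (n + 2)) (orbit n μ θ₀ ξ t)) (ξ t)
      have h2 := Real.sqrt_le_sqrt (potential_step_A1_le n _ hq)
      push_cast
      nlinarith
    · push Not at hq
      have hs := hsep t (by omega)
      rw [orbit_succ_of_pos hs hq, updateCount_succ_of_pos hq]
      have h1 := sqrt_potential_add_le (orbit n μ θ₀ ξ t +
        stepSize (n + 2) • act (A2 (n + 2) μ) (orbit n μ θ₀ ξ t)) (ξ t)
      have h2 := Real.sqrt_le_sqrt
        (potential_step_A2_le n hμ hμ' _ hq (quad_A2_nonpos hs hq))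
      rw [Real.sqrt_mul (sq_nonneg _), Real.sqrt_sq (by positivity)] at h2
      have hc : 1 ≤ 1 + 3 / 4 * growthRate (n + 2) μ := by linarith
      have h3 := mul_le_mul_of_nonneg_left ih (by linarith : 0 ≤ 1 + 3 / 4 * growthRate (n + 2) μ)
      have h4 := one_le_mul_of_one_le_of_one_le hpow hc
      have h5 := mul_le_mul_of_nonneg_right h4 (by linarith : 0 ≤ 3 * R)
      push_cast
      rw [pow_succ]
      linarith

theorem le_abs_inner_orbit (hμ : 0 < μ) {v : Param (n + 2)} (hv₁ : ‖v‖ = 1)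
    (hv : act (A2 (n + 2) μ) v = μ • v) {R : ℝ} {T : ℕ} (hξ : ∀ t < T, ‖ξ t‖ ≤ R)
    (hsep : ∀ t < T, ¬ IsSeparator (n + 2) μ (orbit n μ θ₀ ξ t)) (t : ℕ) (ht : t ≤ T) :
    (1 + growthRate (n + 2) μ) ^ updateCount n μ θ₀ ξ t * (|inner ℝ θ₀ v| - t * R) ≤
      |inner ℝ (orbit n μ θ₀ ξ t) v| := by
  have hε := growthRate_pos n hμ
  induction t with
  | zero => simp [updateCount, iterates]
  | succ t ih =>
    have ih := ih (by omega)
    have hR := hξ t (by omega)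
    have hR0 : 0 ≤ R := (norm_nonneg _).trans hR
    have hpow : 1 ≤ (1 + growthRate (n + 2) μ) ^ updateCount n μ θ₀ ξ t :=
      one_le_pow₀ (by linarith)
    have hξv : |inner ℝ (ξ t) v| ≤ R := by
      have := abs_real_inner_le_norm (ξ t) v
      rw [hv₁, mul_one] at this
      exact this.trans hR
    by_cases hq : quad (A1 (n + 2)) (orbit n μ θ₀ ξ t) ≤ 0
    · rw [orbit_succ_of_nonpos hq, updateCount_succ_of_nonpos hq, inner_add_left,
        inner_step_A1 n hμ hv]
      have h1 := abs_sub_abs_le_abs_add (inner ℝ (orbit n μ θ₀ ξ t) v) (inner ℝ (ξ t) v)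
      push_cast
      nlinarith
    · push Not at hq
      rw [orbit_succ_of_pos (hsep t (by omega)) hq, updateCount_succ_of_pos hq, inner_add_left,
        inner_step_A2 n hv]
      have h1 := abs_sub_abs_le_abs_add
        ((1 + growthRate (n + 2) μ) * inner ℝ (orbit n μ θ₀ ξ t) v) (inner ℝ (ξ t) v)
      have hc : 1 ≤ 1 + growthRate (n + 2) μ := by linarith
      rw [abs_mul, abs_of_pos (by linarith : 0 < 1 + growthRate (n + 2) μ)] at h1
      have h3 := mul_le_mul_of_nonneg_left ih (by linarith : 0 ≤ 1 + growthRate (n + 2) μ)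
      have h4 := one_le_mul_of_one_le_of_one_le hpow hc
      have h5 := mul_le_mul_of_nonneg_right h4 hR0
      push_cast
      rw [pow_succ]
      linarith

theorem escape_orbit_add {t K : ℕ}
    (h : ∀ i < K, quad (A1 (n + 2)) (orbit n μ θ₀ ξ (t + i)) ≤ 0) :
    escape (orbit n μ θ₀ ξ (t + K)) = (1 + √2 / 4) ^ K * escape (orbit n μ θ₀ ξ t) +
      ∑ i ∈ Finset.range K, (1 + √2 / 4) ^ (K - 1 - i) * escape (ξ (t + i)) := by
  induction K with
  | zero => simp
  | succ K ih =>
    rw [← add_assoc, orbit_succ_of_nonpos (h K (by omega)), escape_add, escape_step_A1,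
      ih fun i hi => h i (by omega), Finset.sum_range_succ, mul_add, Finset.mul_sum]
    have : ∑ i ∈ Finset.range K, (1 + √2 / 4) * ((1 + √2 / 4) ^ (K - 1 - i) * escape (ξ (t + i))) =
        ∑ i ∈ Finset.range K, (1 + √2 / 4) ^ (K + 1 - 1 - i) * escape (ξ (t + i)) := by
      refine Finset.sum_congr rfl fun i hi => ?_
      have hi := Finset.mem_range.1 hi
      rw [← mul_assoc, ← pow_succ']
      congr 2; omega
    rw [this]
    simp only [add_tsub_cancel_right, tsub_self, pow_zero, one_mul]
    ring

/-- If the noise is small and drives the iterates away from the stable directions of `A₁`, then a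
separator is found. -/
theorem exists_separator (hμ : 0 < μ) (hμ' : μ ≤ 1 / 10) {v : Param (n + 2)} (hv₁ : ‖v‖ = 1)
    (hv : act (A2 (n + 2) μ) v = μ • v) (hθ : inner ℝ θ₀ v ≠ 0) {R : ℝ} {T K J : ℕ}
    (hξ : ∀ t < T, ‖ξ t‖ ≤ R) (hR : T * R ≤ |inner ℝ θ₀ v| / 1024)
    (hesc : ∀ t < T, 1024 * ‖θ₀‖ ^ 5 / |inner ℝ θ₀ v| ^ 4 <
      |(1 + √2 / 4) ^ K * escape (orbit n μ θ₀ ξ t) +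
        ∑ i ∈ Finset.range K, (1 + √2 / 4) ^ (K - 1 - i) * escape (ξ (t + i))|)
    (hJ : (4 * ‖θ₀‖ / |inner ℝ θ₀ v|) ^ 5 < (1 + growthRate (n + 2) μ) ^ J)
    (hT : J * (K + 1) ≤ T) :
    ∃ t ≤ T, IsSeparator (n + 2) μ (orbit n μ θ₀ ξ t) := by
  by_contra! hsep
  have hε := growthRate_pos n hμ
  have hα : 0 < |inner ℝ θ₀ v| := abs_pos.2 hθ
  have hαθ : |inner ℝ θ₀ v| ≤ ‖θ₀‖ := by
    have := abs_real_inner_le_norm θ₀ v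
    rwa [hv₁, mul_one] at this
  have hθ0 : 0 < ‖θ₀‖ := hα.trans_le hαθ
  have hsep' : ∀ t < T, ¬ IsSeparator (n + 2) μ (orbit n μ θ₀ ξ t) := fun t ht => hsep t ht.le
  -- The correlation stays at least (1 + ε)^N α/2 and the norm at most (1 + 3ε/4)^N · 2‖θ₀‖;
  -- comparing them bounds both powers and hence the norm.
  have hcmp : ∀ t ≤ T,
      (1 + 3 / 4 * growthRate (n + 2) μ) ^ updateCount n μ θ₀ ξ t ≤
        (2 * ‖θ₀‖ / (|inner ℝ θ₀ v| / 2)) ^ 4 ∧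
      (1 + growthRate (n + 2) μ) ^ updateCount n μ θ₀ ξ t ≤
        (2 * ‖θ₀‖ / (|inner ℝ θ₀ v| / 2)) ^ 5 ∧
      ‖orbit n μ θ₀ ξ t‖ ≤ (1 + 3 / 4 * growthRate (n + 2) μ) ^ updateCount n μ θ₀ ξ t *
        (2 * ‖θ₀‖) := by
    intro t ht
    have h1 := sqrt_potential_orbit_le hμ hμ' hξ hsep' t ht
    have h2 := le_abs_inner_orbit hμ hv₁ hv hξ hsep' t ht
    have h3 : |inner ℝ (orbit n μ θ₀ ξ t) v| ≤ ‖orbit n μ θ₀ ξ t‖ := by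
      have := abs_real_inner_le_norm (orbit n μ θ₀ ξ t) v
      rwa [hv₁, mul_one] at this
    have h4 := norm_le_sqrt_potential (orbit n μ θ₀ ξ t)
    have htR : t * R ≤ |inner ℝ θ₀ v| / 1024 := by
      -- For T = 0 nothing forces R to be nonnegative.
      rcases Nat.eq_zero_or_pos T with h0 | h0
      · have : t = 0 := by omega
        rw [this, Nat.cast_zero, zero_mul]; positivity
      · have hR0 : 0 ≤ R := (norm_nonneg _).trans (hξ 0 h0)
        exact (mul_le_mul_of_nonneg_right (Nat.cast_le.2 ht) hR0).trans hR
    have h5 : √(potential θ₀) + t * (3 * R) ≤ 2 * ‖θ₀‖ := by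
      have := sqrt_potential_le θ₀
      linarith
    have hpow : 0 < (1 + 3 / 4 * growthRate (n + 2) μ) ^ updateCount n μ θ₀ ξ t := by positivity
    have hpow' : 0 < (1 + growthRate (n + 2) μ) ^ updateCount n μ θ₀ ξ t := by positivity
    have h6 := mul_le_mul_of_nonneg_left h5 hpow.le
    have h7 : (1 + growthRate (n + 2) μ) ^ updateCount n μ θ₀ ξ t * (|inner ℝ θ₀ v| / 2) ≤
        (1 + growthRate (n + 2) μ) ^ updateCount n μ θ₀ ξ t * (|inner ℝ θ₀ v| - t * R) :=
      mul_le_mul_of_nonneg_left (by linarith) hpow'.le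
    have h8 := growth_comparison hε (growthRate_le n hμ') (half_pos hα)
      (by positivity : 0 < 2 * ‖θ₀‖) (h7.trans (h2.trans (h3.trans (h4.trans (h1.trans h6)))))
    exact ⟨h8.1, h8.2, h4.trans (h1.trans h6)⟩
  have hquot : 2 * ‖θ₀‖ / (|inner ℝ θ₀ v| / 2) = 4 * ‖θ₀‖ / |inner ℝ θ₀ v| := by
    field_simp; norm_num
  -- every block of `K + 1` consecutive steps contains a step along `A₂`
  have hblock : ∀ t, t + (K + 1) ≤ T →
      updateCount n μ θ₀ ξ t + 1 ≤ updateCount n μ θ₀ ξ (t + (K + 1)) := by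
    intro t ht
    suffices ∃ i < K + 1, 0 < quad (A1 (n + 2)) (orbit n μ θ₀ ξ (t + i)) by
      obtain ⟨i, hi, hpos⟩ := this
      calc updateCount n μ θ₀ ξ t + 1 ≤ updateCount n μ θ₀ ξ (t + i) + 1 :=
            Nat.add_le_add_right (updateCount_mono (by omega)) 1
        _ = updateCount n μ θ₀ ξ (t + i + 1) := (updateCount_succ_of_pos hpos).symm
        _ ≤ _ := updateCount_mono (by omega)
    -- Failure at times t, …, t + K - 1 gives the unrolled escape coordinate at time t + K, which is
    -- too large for the test to fail there too. The threshold is 1024 = 2 · 4⁴ · 2.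
    by_contra! hall
    have hK := hall K (by omega)
    refine absurd (quad_A1_pos_of_escape n ?_) (not_lt.2 hK)
    rw [escape_orbit_add fun i hi => hall i (by omega)]
    refine lt_of_le_of_lt ?_ (hesc t (by omega))
    obtain ⟨h1, -, h3⟩ := hcmp (t + K) (by omega)
    rw [hquot] at h1
    calc 2 * ‖orbit n μ θ₀ ξ (t + K)‖ ≤ 2 * ((4 * ‖θ₀‖ / |inner ℝ θ₀ v|) ^ 4 * (2 * ‖θ₀‖)) := by
          have := mul_le_mul_of_nonneg_right h1 (by positivity : 0 ≤ 2 * ‖θ₀‖)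
          linarith
      _ = _ := by rw [div_pow]; ring
  have hcount : ∀ j, j * (K + 1) ≤ T → j ≤ updateCount n μ θ₀ ξ (j * (K + 1)) := by
    intro j
    induction j with
    | zero => simp
    | succ j ih =>
      intro hj
      rw [Nat.add_one_mul] at hj ⊢
      have := ih (by omega)
      have := hblock _ hj
      omega
  -- After J blocks there are at least J steps along A₂, against `hJ`.
  have h1 := (hcmp _ hT).2.1
  rw [hquot] at h1
  have h2 := pow_le_pow_right₀ (by linarith : 1 ≤ 1 + growthRate (n + 2) μ) (hcount J hT)
  linarith

end Trajectory

/-! ### Gaussian tail and anti-concentration estimates. -/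

section Gaussian

open scoped NNReal ENNReal

/-- The weight exp(x²/4) turns the density of N(0,1) into √2 times that of N(0,2). -/
theorem integral_exp_sq_gaussianReal : ∫ x, Real.exp (x ^ 2 / 4) ∂gaussianReal 0 1 = √2 := by
  rw [integral_gaussianReal_eq_integral_smul one_ne_zero]
  have h : ∀ x : ℝ, gaussianPDFReal 0 1 x • Real.exp (x ^ 2 / 4) =
      √2 * gaussianPDFReal 0 2 x := by
    intro x
    have e1 : √(2 * Real.pi * (2 : ℝ≥0)) = √2 * √(2 * Real.pi * (1 : ℝ≥0)) := by
      rw [← Real.sqrt_mul (by norm_num)]; push_cast; congr 1; ring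
    rw [gaussianPDFReal, gaussianPDFReal, e1, smul_eq_mul, mul_assoc, ← Real.exp_add]
    have e2 : -(x - 0) ^ 2 / (2 * ((1 : ℝ≥0) : ℝ)) + x ^ 2 / 4 =
      -(x - 0) ^ 2 / (2 * ((2 : ℝ≥0) : ℝ)) := by push_cast; ring
    rw [e2]
    have : √2 ≠ 0 := by positivity
    have : √(2 * Real.pi * (1 : ℝ≥0)) ≠ 0 := by push_cast; positivity
    field_simp
  simp_rw [h]
  rw [integral_const_mul, integral_gaussianPDFReal_eq_one 0 two_ne_zero, mul_one]

theorem integrable_exp_sq_gaussianReal :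
    Integrable (fun x => Real.exp (x ^ 2 / 4)) (gaussianReal 0 1) := by
  by_contra h
  have := integral_exp_sq_gaussianReal
  -- A non-integrable function has integral 0 by convention, but the value is √2.
  rw [integral_undef h] at this
  exact absurd this.symm (by positivity)

/-- Chernoff's bound for the norm of a standard Gaussian vector. -/
theorem stdGaussian_real_norm_sq_ge_le {ι : Type*} [Fintype ι] (a : ℝ) :
    (stdGaussian (EuclideanSpace ℝ ι)).real {x | a ≤ ‖x‖ ^ 2} ≤
      √2 ^ Fintype.card ι * Real.exp (-a / 4) := by
  have hprod : ∀ x : ι → ℝ, Real.exp (‖WithLp.toLp 2 x‖ ^ 2 / 4) =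
      ∏ i, Real.exp (x i ^ 2 / 4) := by
    intro x
    rw [← Real.exp_sum, EuclideanSpace.real_norm_sq_eq, Finset.sum_div]
  rw [← map_pi_eq_stdGaussian, map_measureReal_apply (by fun_prop)
    (measurableSet_le measurable_const (by fun_prop))]
  have hint : Integrable (fun x : ι → ℝ => ∏ i, Real.exp (x i ^ 2 / 4))
      (Measure.pi fun _ => gaussianReal 0 1) :=
    Integrable.fintype_prod (f := fun _ x => Real.exp (x ^ 2 / 4))
      fun _ => integrable_exp_sq_gaussianReal
  have hval : ∫ x : ι → ℝ, ∏ i, Real.exp (x i ^ 2 / 4) ∂Measure.pi (fun _ => gaussianReal 0 1) =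
      √2 ^ Fintype.card ι := by
    rw [integral_fintype_prod_eq_prod (f := fun _ x => Real.exp (x ^ 2 / 4))]
    simp [integral_exp_sq_gaussianReal]
  have hM := mul_meas_ge_le_integral_of_nonneg
    (ae_of_all _ fun x => Finset.prod_nonneg fun i _ => (Real.exp_pos _).le) hint
    (Real.exp (a / 4))
  rw [hval] at hM
  have hset : (WithLp.toLp 2 : (ι → ℝ) → EuclideanSpace ℝ ι) ⁻¹' {x | a ≤ ‖x‖ ^ 2} =
      {x | Real.exp (a / 4) ≤ ∏ i, Real.exp (x i ^ 2 / 4)} := by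
    ext x
    simp only [Set.mem_preimage, Set.mem_ofPred_eq]
    rw [← hprod, Real.exp_le_exp]
    constructor <;> intro h <;> linarith
  rw [hset, neg_div, Real.exp_neg, ← div_eq_mul_inv, le_div_iff₀ (Real.exp_pos _), mul_comm]
  exact hM

theorem multivariateGaussian_sq_smul_one {ι : Type*} [Fintype ι] [DecidableEq ι] (σ : ℝ) :
    multivariateGaussian 0 (σ ^ 2 • (1 : Matrix ι ι ℝ)) =
      (stdGaussian (EuclideanSpace ℝ ι)).map (σ • ·) := by
  have hS : (σ ^ 2 • (1 : Matrix ι ι ℝ)).PosSemidef := Matrix.PosSemidef.one.smul (sq_nonneg σ)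
  have : IsProbabilityMeasure ((stdGaussian (EuclideanSpace ℝ ι)).map (σ • ·)) :=
    Measure.isProbabilityMeasure_map (by fun_prop)
  apply Measure.ext_of_charFun
  ext t
  rw [charFun_multivariateGaussian hS, charFun_map_smul, charFun_stdGaussian, norm_smul]
  congr 1
  have ht : t.ofLp ⬝ᵥ t.ofLp = ‖t‖ ^ 2 := by
    rw [EuclideanSpace.real_norm_sq_eq]; simp [dotProduct, sq]
  have hσ : (‖σ‖ * ‖t‖) ^ 2 = σ ^ 2 * ‖t‖ ^ 2 := by rw [mul_pow, Real.norm_eq_abs, sq_abs]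
  rw [inner_zero_right, Matrix.smul_mulVec, Matrix.one_mulVec, dotProduct_smul, ht, smul_eq_mul,
    ← Complex.ofReal_pow, hσ]
  simp [neg_div]

theorem map_inner_multivariateGaussian {ι : Type*} [Fintype ι] [DecidableEq ι] (σ : ℝ)
    (w : EuclideanSpace ℝ ι) :
    (multivariateGaussian 0 (σ ^ 2 • (1 : Matrix ι ι ℝ))).map (fun x => inner ℝ w x) =
      gaussianReal 0 (σ ^ 2 * ‖w‖ ^ 2).toNNReal := by
  have hL : (fun x : EuclideanSpace ℝ ι => inner ℝ w x) = innerSL ℝ w := rfl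
  rw [multivariateGaussian_sq_smul_one, Measure.map_map (by fun_prop) (by fun_prop)]
  have hc : (fun x : EuclideanSpace ℝ ι => inner ℝ w x) ∘ (σ • ·) =
      ⇑(σ • innerSL ℝ w : StrongDual ℝ (EuclideanSpace ℝ ι)) := by
    ext x; simp [inner_smul_right]
  rw [hc, IsGaussian.map_eq_gaussianReal, integral_strongDual_stdGaussian,
    variance_dual_stdGaussian, norm_smul, mul_pow, innerSL_apply_norm, Real.norm_eq_abs, sq_abs]

/-- The density is at most 1/√(2πv) ≤ 1/(2√v), and the event is an interval of length 2Δ/c. -/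
theorem gaussianReal_real_abs_le {v : ℝ} (hv : 0 < v) {c : ℝ} (hc : 0 < c) (y Δ : ℝ) :
    gaussianReal 0 v.toNNReal {x | |y + c * x| ≤ Δ} ≤ ENNReal.ofReal (Δ / (c * √v)) := by
  have hv' : v.toNNReal ≠ 0 := by simpa using hv
  have hpdf : ∀ x, gaussianPDF 0 v.toNNReal x ≤ ENNReal.ofReal (1 / (2 * √v)) := by
    intro x
    refine ENNReal.ofReal_le_ofReal ?_
    rw [gaussianPDFReal, Real.coe_toNNReal _ hv.le]
    have e1 : Real.exp (-(x - 0) ^ 2 / (2 * v)) ≤ 1 := by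
      rw [Real.exp_le_one_iff]
      exact div_nonpos_of_nonpos_of_nonneg (neg_nonpos.2 (sq_nonneg _)) (by positivity)
    have e2 : 2 * √v ≤ √(2 * Real.pi * v) := by
      rw [Real.sqrt_mul (by positivity)]
      refine mul_le_mul_of_nonneg_right ?_ (Real.sqrt_nonneg v)
      refine Real.le_sqrt_of_sq_le ?_
      nlinarith [Real.pi_gt_three]
    calc (√(2 * Real.pi * v))⁻¹ * Real.exp (-(x - 0) ^ 2 / (2 * v))
        ≤ (√(2 * Real.pi * v))⁻¹ * 1 := by gcongr
      _ ≤ (2 * √v)⁻¹ := by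
        rw [mul_one]; exact inv_anti₀ (by positivity) e2
      _ = _ := by rw [one_div]
  have hset : {x : ℝ | |y + c * x| ≤ Δ} ⊆ Set.Icc ((-Δ - y) / c) ((Δ - y) / c) := by
    intro x hx
    rw [Set.mem_ofPred_eq] at hx
    obtain ⟨h1, h2⟩ := abs_le.1 hx
    exact ⟨by rw [div_le_iff₀ hc]; linarith, by rw [le_div_iff₀ hc]; linarith⟩
  refine (measure_mono hset).trans ?_
  rw [gaussianReal_apply 0 hv']
  calc ∫⁻ x in Set.Icc ((-Δ - y) / c) ((Δ - y) / c), gaussianPDF 0 v.toNNReal x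
      ≤ ∫⁻ _ in Set.Icc ((-Δ - y) / c) ((Δ - y) / c), ENNReal.ofReal (1 / (2 * √v)) :=
        lintegral_mono hpdf
    _ = ENNReal.ofReal (Δ / (c * √v)) := by
      rw [setLIntegral_const, Real.volume_Icc, ← ENNReal.ofReal_mul (by positivity)]
      congr 1
      field_simp
      ring

/-- Fubini: conditionally on Y, the independent Z still has its own law, so a bound uniform in the
shift y survives. -/
theorem measure_abs_add_mul_le {Ω : Type*} [MeasurableSpace Ω] {P : Measure Ω}
    [IsProbabilityMeasure P] {Y Z : Ω → ℝ} (hY : AEMeasurable Y P) (hZ : AEMeasurable Z P)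
    (hYZ : IndepFun Y Z P) {c Δ : ℝ} {b : ℝ≥0∞}
    (hb : ∀ y, P.map Z {z | |y + c * z| ≤ Δ} ≤ b) :
    P {ω | |Y ω + c * Z ω| ≤ Δ} ≤ b := by
  have hS : MeasurableSet {p : ℝ × ℝ | |p.1 + c * p.2| ≤ Δ} :=
    measurableSet_le (by fun_prop) measurable_const
  have : IsProbabilityMeasure (P.map Y) := Measure.isProbabilityMeasure_map hY
  have : IsProbabilityMeasure (P.map Z) := Measure.isProbabilityMeasure_map hZ
  have h : P {ω | |Y ω + c * Z ω| ≤ Δ} =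
      P.map (fun ω => (Y ω, Z ω)) {p : ℝ × ℝ | |p.1 + c * p.2| ≤ Δ} := by
    rw [Measure.map_apply_of_aemeasurable (hY.prodMk hZ) hS]; rfl
  rw [h, (indepFun_iff_map_prod_eq_prod_map_map hY hZ).1 hYZ, Measure.prod_apply hS]
  calc ∫⁻ y, P.map Z (Prod.mk y ⁻¹' {p : ℝ × ℝ | |p.1 + c * p.2| ≤ Δ}) ∂P.map Y
      ≤ ∫⁻ _, b ∂P.map Y := lintegral_mono fun y => hb y
    _ = b := by simp

end Gaussian

/-! ### Probabilities of the bad events. -/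

section Probability

variable {Ω : Type*} [MeasurableSpace Ω] {P : Measure Ω}

theorem measureReal_norm_noise_gt_le {d : ℕ} (hd : 2 ≤ d) {X : Ω → Param d} {σ M T ρ : ℝ}
    (hσ : 0 < σ) (hX : HasLaw X (multivariateGaussian 0
      (σ ^ 2 • (1 : Matrix (Fin 2 ⊕ Fin d) (Fin 2 ⊕ Fin d) ℝ))) P)
    (hT : 0 < T) (hρ : 0 < ρ) (hM : (d : ℝ) ≤ M) (hM' : Real.log (T / ρ) ≤ M) :
    P.real {ω | 4 * σ * √M < ‖X ω‖} ≤ ρ / (2 * T) := by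
  have hd' : (2 : ℝ) ≤ d := by exact_mod_cast hd
  have hmeas : MeasurableSet {x : Param d | 4 * σ * √M < ‖x‖} :=
    measurableSet_lt measurable_const (by fun_prop)
  rw [hX.measureReal_eq hmeas, multivariateGaussian_sq_smul_one,
    map_measureReal_apply (by fun_prop) hmeas]
  have hsub : (σ • ·) ⁻¹' {x : Param d | 4 * σ * √M < ‖x‖} ⊆ {x | 16 * M ≤ ‖x‖ ^ 2} := by
    intro x hx
    simp only [Set.mem_preimage, Set.mem_ofPred_eq, norm_smul, Real.norm_eq_abs,
      abs_of_pos hσ] at hx ⊢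
    have h1 : 4 * √M < ‖x‖ := by
      refine lt_of_mul_lt_mul_left ?_ hσ.le
      linarith
    have h2 : √M ^ 2 = M := Real.sq_sqrt (by linarith)
    have h3 := pow_le_pow_left₀ (by positivity) h1.le 2
    rw [mul_pow, h2] at h3
    linarith
  refine (measureReal_mono hsub).trans ((stdGaussian_real_norm_sq_ge_le _).trans ?_)
  have hcard : Fintype.card (Fin 2 ⊕ Fin d) ≤ 2 * d := by simp; omega
  have h2 : √2 ^ Fintype.card (Fin 2 ⊕ Fin d) ≤ Real.exp M := by
    calc √2 ^ Fintype.card (Fin 2 ⊕ Fin d) ≤ √2 ^ (2 * d) :=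
          pow_le_pow_right₀ (Real.one_le_sqrt.2 (by norm_num)) hcard
      _ = 2 ^ d := by rw [pow_mul, Real.sq_sqrt (by norm_num)]
      _ ≤ Real.exp 1 ^ d := by
        gcongr; linarith [Real.add_one_le_exp 1]
      _ = Real.exp d := by rw [← Real.exp_nat_mul, mul_one]
      _ ≤ Real.exp M := Real.exp_le_exp.2 hM
  have h3 : Real.exp (-M) ≤ ρ / T := by
    have : Real.log (ρ / T) = -Real.log (T / ρ) := by
      rw [← Real.log_inv, inv_div]
    rw [← Real.exp_log (div_pos hρ hT), this]
    exact Real.exp_le_exp.2 (by linarith)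
  have h4 : Real.exp (-(2 * M)) ≤ 1 / 2 := by
    rw [Real.exp_neg, one_div]
    exact inv_anti₀ (by norm_num) (by linarith [Real.add_one_le_exp (2 * M)])
  -- Of the exponent -4M, one M pays for the dimension, one gives ρ/T and the other two give the
  -- factor 1/2.
  calc √2 ^ Fintype.card (Fin 2 ⊕ Fin d) * Real.exp (-(16 * M) / 4)
      ≤ Real.exp M * Real.exp (-(16 * M) / 4) := by gcongr
    _ = Real.exp (-M) * Real.exp (-(2 * M)) := by
      rw [← Real.exp_add, ← Real.exp_add]; ring_nf
    _ ≤ ρ / T * (1 / 2) := by gcongr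
    _ = _ := by field_simp

theorem measurable_act {d : ℕ} (A : Matrix (Fin 2 ⊕ Fin d) (Fin 2 ⊕ Fin d) ℝ) :
    Measurable (act A : Param d → Param d) := by
  have : Continuous (act A : Param d → Param d) := by unfold act; fun_prop
  exact this.measurable

theorem measurable_quad {d : ℕ} (A : Matrix (Fin 2 ⊕ Fin d) (Fin 2 ⊕ Fin d) ℝ) :
    Measurable (quad A : Param d → ℝ) := by
  have : Continuous (quad A : Param d → ℝ) := by unfold quad; fun_prop
  exact this.measurable

theorem measurable_escape {d : ℕ} : Measurable (escape : Param d → ℝ) := by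
  unfold escape; fun_prop

theorem measurable_step (d : ℕ) (μ γ : ℝ) :
    Measurable fun p : Param d × Param d => step d μ γ p.1 p.2 := by
  unfold step
  refine Measurable.ite (measurableSet_le ((measurable_quad _).comp measurable_fst)
    measurable_const) ?_ (Measurable.ite (measurableSet_le ((measurable_quad _).comp
    measurable_fst) measurable_const) ?_ measurable_fst)
  · exact (measurable_fst.add (((measurable_act _).comp measurable_fst).const_smul γ)).add
      measurable_snd
  · exact (measurable_fst.add (((measurable_act _).comp measurable_fst).const_smul γ)).add
      measurable_snd

theorem measurable_iterates {α : Type*} [MeasurableSpace α] {d : ℕ} {μ γ : ℝ} {θ₀ : Param d}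
    {ξ : ℕ → α → Param d} (hξ : ∀ t, Measurable (ξ t)) (t : ℕ) :
    Measurable fun a => iterates d μ γ θ₀ (fun s => ξ s a) t := by
  induction t with
  | zero => exact measurable_const
  | succ t ih => exact (measurable_step d μ γ).comp (ih.prodMk (hξ t))

theorem iterates_congr {d : ℕ} {μ γ : ℝ} {θ₀ : Param d} {ξ ξ' : ℕ → Param d} {t : ℕ}
    (h : ∀ s < t, ξ s = ξ' s) : iterates d μ γ θ₀ ξ t = iterates d μ γ θ₀ ξ' t := by
  induction t with
  | zero => rfl
  | succ t ih =>
    rw [iterates, iterates, ih fun s hs => h s (by omega), h t (by omega)]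

/-- The coordinate along `escapeVec` after `K + 1` steps along `A₁` is anti-concentrated. -/
theorem measureReal_escape_le [IsProbabilityMeasure P] {n : ℕ} {μ σ : ℝ} (hσ : 0 < σ) {θ₀ : Param (n + 2)}
    {ξ : ℕ → Ω → Param (n + 2)} (hindep : iIndepFun ξ P)
    (hlaw : ∀ t, HasLaw (ξ t) (multivariateGaussian 0
      (σ ^ 2 • (1 : Matrix (Fin 2 ⊕ Fin (n + 2)) (Fin 2 ⊕ Fin (n + 2)) ℝ))) P)
    (t K : ℕ) {Δ : ℝ} (hΔ : 0 ≤ Δ) :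
    P.real {ω | |(1 + √2 / 4) ^ (K + 1) * escape (orbit n μ θ₀ (fun s => ξ s ω) t) +
      ∑ i ∈ Finset.range (K + 1), (1 + √2 / 4) ^ (K + 1 - 1 - i) * escape (ξ (t + i) ω)| ≤ Δ} ≤
      Δ / ((1 + √2 / 4) ^ K * (2 * σ)) := by
  classical
  -- The noise at time t is isolated: the orbit at time t depends on earlier noise only, so
  -- everything else is a function of the noise at the times in S. The value 0 of `extend` off S is
  -- never used.
  set S := (Finset.range (t + (K + 1))).erase t with hS
  have hdisj : Disjoint S {t} := by simp [hS]
  have hind := hindep.indepFun_finset₀ S {t} hdisj fun i => (hlaw i).aemeasurable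
  -- the contribution of the noise at the times other than `t`
  let extend : ℕ → (S → Param (n + 2)) → Param (n + 2) :=
    fun s x => if h : s ∈ S then x ⟨s, h⟩ else 0
  have hext : ∀ s, Measurable (extend s) := by
    intro s
    by_cases h : s ∈ S
    · simp only [extend, h, dif_pos]; fun_prop
    · simp only [extend, h, dif_neg, not_false_eq_true]; exact measurable_const
  let F : (S → Param (n + 2)) → ℝ := fun x =>
    (1 + √2 / 4) ^ (K + 1) * escape (orbit n μ θ₀ (fun s => extend s x) t) +
      ∑ i ∈ Finset.range K, (1 + √2 / 4) ^ (K - (i + 1)) * escape (extend (t + (i + 1)) x)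
  have hF : Measurable F := by
    refine ((measurable_escape.comp (measurable_iterates hext t)).const_mul _).add ?_
    exact Finset.measurable_sum _ fun i _ => (measurable_escape.comp (hext _)).const_mul _
  let G : (({t} : Finset ℕ) → Param (n + 2)) → ℝ :=
    fun x => escape (x ⟨t, Finset.mem_singleton_self t⟩)
  have hG : Measurable G := measurable_escape.comp (measurable_pi_apply _)
  have hYZ := hind.comp hF hG
  have htuple : AEMeasurable (fun ω (i : S) => ξ i ω) P :=
    aemeasurable_pi_lambda _ fun i => (hlaw i).aemeasurable
  have hY : AEMeasurable (F ∘ fun ω (i : S) => ξ i ω) P := hF.comp_aemeasurable htuple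
  have hZ : AEMeasurable (fun ω => escape (ξ t ω)) P :=
    measurable_escape.comp_aemeasurable (hlaw t).aemeasurable
  have hlawZ : P.map (fun ω => escape (ξ t ω)) = gaussianReal 0 (σ ^ 2 * 4).toNNReal := by
    have h := map_inner_multivariateGaussian σ (escapeVec (n + 2))
    rw [norm_sq_escapeVec, ← (hlaw t).map_eq, AEMeasurable.map_map_of_aemeasurable
      (by fun_prop) (hlaw t).aemeasurable] at h
    exact h
  have hsqrt : √(σ ^ 2 * 4) = 2 * σ := by
    rw [show σ ^ 2 * 4 = (2 * σ) ^ 2 by ring, Real.sqrt_sq (by positivity)]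
  -- The noise at time t enters with the largest weight (1 + √2/4)^K, and its escape coordinate has
  -- standard deviation 2σ because `escapeVec` has norm 2.
  have hbound := measure_abs_add_mul_le hY hZ hYZ (c := (1 + √2 / 4) ^ K) (Δ := Δ)
    (b := ENNReal.ofReal (Δ / ((1 + √2 / 4) ^ K * (2 * σ)))) fun y => by
      rw [hlawZ, ← hsqrt]
      exact gaussianReal_real_abs_le (by positivity) (by positivity) y Δ
  refine ENNReal.toReal_le_of_le_ofReal (by positivity) (le_trans (le_of_eq ?_) hbound)
  congr 1
  ext ω
  have hextω : ∀ s ∈ S, extend s (fun i : S => ξ i ω) = ξ s ω := fun s hs => by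
    simp only [extend, hs, dif_pos]
  have horb : orbit n μ θ₀ (fun s => extend s fun i : S => ξ i ω) t =
      orbit n μ θ₀ (fun s => ξ s ω) t :=
    iterates_congr fun s hs => hextω s (by simp [hS]; omega)
  have hval : (F ∘ fun ω (i : S) => ξ i ω) ω + (1 + √2 / 4) ^ K * escape (ξ t ω) =
      (1 + √2 / 4) ^ (K + 1) * escape (orbit n μ θ₀ (fun s => ξ s ω) t) +
      ∑ i ∈ Finset.range (K + 1), (1 + √2 / 4) ^ (K + 1 - 1 - i) * escape (ξ (t + i) ω) := by
    simp only [Function.comp_apply, F, horb]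
    rw [Finset.sum_range_succ']
    have : ∑ i ∈ Finset.range K, (1 + √2 / 4) ^ (K - (i + 1)) *
        escape (extend (t + (i + 1)) fun i : S => ξ i ω) = ∑ i ∈ Finset.range K,
          (1 + √2 / 4) ^ (K + 1 - 1 - (i + 1)) * escape (ξ (t + (i + 1)) ω) := by
      refine Finset.sum_congr rfl fun i hi => ?_
      have hi := Finset.mem_range.1 hi
      rw [hextω _ (by simp [hS]; omega), add_tsub_cancel_right]
    rw [this]
    simp only [add_tsub_cancel_right, tsub_zero, add_zero]
    ring
  rw [Set.mem_ofPred_eq, Set.mem_ofPred_eq, hval]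

/-- Union bound over 2T bad events. Only subadditivity is used, so no measurability of the sets is
needed. -/
theorem one_sub_le_measureReal_of_compl [IsProbabilityMeasure P] {s : Set Ω} {T : ℕ} {f g : ℕ → Set Ω} {ρ : ℝ}
    (hT : 0 < T) (hf : ∀ t < T, P.real (f t) ≤ ρ / (2 * T))
    (hg : ∀ t < T, P.real (g t) ≤ ρ / (2 * T))
    (hs : ∀ ω, (∀ t < T, ω ∉ f t ∧ ω ∉ g t) → ω ∈ s) : 1 - ρ ≤ P.real s := by
  have hcov : (Set.univ : Set Ω) ⊆ s ∪ ⋃ t ∈ Finset.range T, (f t ∪ g t) := by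
    intro ω _
    by_cases h : ∀ t < T, ω ∉ f t ∧ ω ∉ g t
    · exact Or.inl (hs ω h)
    · push Not at h
      obtain ⟨t, ht, h⟩ := h
      refine Or.inr (Set.mem_biUnion (Finset.mem_coe.2 (Finset.mem_range.2 ht)) ?_)
      by_cases hω : ω ∈ f t
      · exact Or.inl hω
      · exact Or.inr (h hω)
  have h1 : (1 : ℝ) ≤ P.real s + P.real (⋃ t ∈ Finset.range T, (f t ∪ g t)) := by
    rw [← probReal_univ (μ := P)]
    exact (measureReal_mono hcov).trans (measureReal_union_le _ _)
  have h2 : P.real (⋃ t ∈ Finset.range T, (f t ∪ g t)) ≤ ρ := by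
    calc _ ≤ ∑ t ∈ Finset.range T, P.real (f t ∪ g t) := measureReal_biUnion_finset_le _ _
      _ ≤ ∑ t ∈ Finset.range T, ρ / T := by
        refine Finset.sum_le_sum fun t ht => (measureReal_union_le _ _).trans ?_
        have ht := Finset.mem_range.1 ht
        have e : ρ / T = ρ / (2 * T) + ρ / (2 * T) := by
          have : (T : ℝ) ≠ 0 := by positivity
          field_simp; norm_num
        rw [e]
        exact add_le_add (hf t ht) (hg t ht)
      _ = ρ := by
        have : (T : ℝ) ≠ 0 := by positivity
        rw [Finset.sum_const, Finset.card_range, nsmul_eq_mul]; field_simp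
  linarith

end Probability

/-! ### Arithmetic of the constants A, B, T and the block lengths. -/

section Parameters

/-- The constant `A` as a function of `D = √d / μ` and `q = ‖θ₀‖² / ⟨θ₀, v⟩²`. -/
def paramA (D q ρ : ℝ) : ℝ :=
  2 ^ 27 * Real.log (2 ^ 62 * q / ρ ^ 3) * Real.log (2 ^ 15 * D * q)

theorem constA_eq (d : ℕ) (μ ρ : ℝ) (θ₀ v : Param d) :
    constA d μ ρ θ₀ v = paramA (√(d : ℝ) / μ) (‖θ₀‖ ^ 2 / inner ℝ θ₀ v ^ 2) ρ := by
  have e1 : 2 ^ 62 * ‖θ₀‖ ^ 2 / (ρ ^ 3 * inner ℝ θ₀ v ^ 2) =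
    2 ^ 62 * (‖θ₀‖ ^ 2 / inner ℝ θ₀ v ^ 2) / ρ ^ 3 := by
    ring
  have e2 : 2 ^ 15 * √(d : ℝ) * ‖θ₀‖ ^ 2 / (μ * inner ℝ θ₀ v ^ 2) =
    2 ^ 15 * (√(d : ℝ) / μ) * (‖θ₀‖ ^ 2 / inner ℝ θ₀ v ^ 2) := by
    ring
  rw [constA, paramA, e1, e2]

theorem logFactor_eq (d : ℕ) (μ ρ : ℝ) (θ₀ v : Param d) :
    logFactor d μ ρ θ₀ v =
      Real.log (√(d : ℝ) / μ * (‖θ₀‖ ^ 2 / inner ℝ θ₀ v ^ 2) / ρ) := by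
  rw [logFactor, div_mul_div_comm, div_div]
  congr 2; ring

variable {D q ρ : ℝ}

theorem log_mul_div_pow (hq : 1 ≤ q) (hρ : 0 < ρ) :
    Real.log (2 ^ 62 * q / ρ ^ 3) = 62 * Real.log 2 + Real.log q - 3 * Real.log ρ := by
  rw [Real.log_div (by positivity) (by positivity), Real.log_mul (by positivity) (by positivity),
    Real.log_pow, Real.log_pow]
  push_cast; rfl

theorem log_pow_mul_mul (hD : 14 ≤ D) (hq : 1 ≤ q) :
    Real.log (2 ^ 15 * D * q) = 15 * Real.log 2 + Real.log D + Real.log q := by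
  rw [Real.log_mul (by positivity) (by positivity), Real.log_mul (by positivity) (by positivity),
    Real.log_pow]
  push_cast; rfl

theorem log_mul_div (hD : 14 ≤ D) (hq : 1 ≤ q) (hρ : 0 < ρ) :
    Real.log (D * q / ρ) = Real.log D + Real.log q - Real.log ρ := by
  rw [Real.log_div (by positivity) (by positivity), Real.log_mul (by positivity) (by positivity)]

theorem two_le_log (hD : 14 ≤ D) : 2 ≤ Real.log D := by
  rw [Real.le_log_iff_exp_le (by linarith), show (2 : ℝ) = 1 + 1 by norm_num, Real.exp_add]
  nlinarith [Real.exp_one_lt_d9, Real.exp_pos 1]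

theorem one_le_log_fst (hq : 1 ≤ q) (hρ : 0 < ρ) (hρ' : ρ ≤ 1) :
    1 ≤ Real.log (2 ^ 62 * q / ρ ^ 3) := by
  rw [log_mul_div_pow hq hρ]
  linarith [Real.log_two_gt_d9, Real.log_nonneg hq, Real.log_nonpos hρ.le hρ']

theorem one_le_log_snd (hD : 14 ≤ D) (hq : 1 ≤ q) : 1 ≤ Real.log (2 ^ 15 * D * q) := by
  rw [log_pow_mul_mul hD hq]
  linarith [Real.log_two_gt_d9, Real.log_nonneg hq, two_le_log hD]

theorem one_le_paramA (hD : 14 ≤ D) (hq : 1 ≤ q) (hρ : 0 < ρ) (hρ' : ρ ≤ 1) :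
    1 ≤ paramA D q ρ := by
  have h1 := one_le_log_fst hq hρ hρ'
  have h2 := one_le_log_snd hD hq
  have h3 := one_le_mul_of_one_le_of_one_le h1 h2
  rw [paramA]; linarith

theorem two_le_log_mul_paramA (hD : 14 ≤ D) (hq : 1 ≤ q) (hρ : 0 < ρ) (hρ' : ρ ≤ 1) :
    2 ≤ Real.log (D * paramA D q ρ) := by
  have hA := one_le_paramA hD hq hρ hρ'
  rw [Real.log_mul (by positivity) (by positivity)]
  linarith [two_le_log hD, Real.log_nonneg hA]

/-- Since L = log(Dq/ρ) ≥ log D ≥ 2, additive constants are absorbed into multiples of L: the two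
logarithms in A are at most 25L and 7L, and 175 = 25 · 7. The iterated logarithms are bounded
through log x ≤ x - 1. -/
theorem paramA_bounds (hD : 14 ≤ D) (hq : 1 ≤ q) (hρ : 0 < ρ) (hρ' : ρ ≤ 1) :
    paramA D q ρ ≤ 2 ^ 27 * 175 * Real.log (D * q / ρ) ^ 2 ∧
      Real.log (D * paramA D q ρ) ≤ 43 * Real.log (D * q / ρ) := by
  have h1 := one_le_log_fst hq hρ hρ'
  have h2 := one_le_log_snd hD hq
  have hA := one_le_paramA hD hq hρ hρ'
  have hlD := two_le_log hD
  have hlq := Real.log_nonneg hq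
  have hlρ := Real.log_nonpos hρ.le hρ'
  have hl2 := Real.log_two_lt_d9
  have hL := log_mul_div hD hq hρ
  have b1 : Real.log (2 ^ 62 * q / ρ ^ 3) ≤ 25 * Real.log (D * q / ρ) := by
    rw [log_mul_div_pow hq hρ, hL]; linarith
  have b2 : Real.log (2 ^ 15 * D * q) ≤ 7 * Real.log (D * q / ρ) := by
    rw [log_pow_mul_mul hD hq, hL]; linarith
  have b3 := mul_le_mul b1 b2 (by linarith) (by rw [hL]; linarith)
  refine ⟨by rw [paramA]; nlinarith, ?_⟩
  have e : Real.log (paramA D q ρ) = 27 * Real.log 2 +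
      Real.log (Real.log (2 ^ 62 * q / ρ ^ 3)) + Real.log (Real.log (2 ^ 15 * D * q)) := by
    rw [paramA, Real.log_mul (by positivity) (by positivity),
      Real.log_mul (by positivity) (by positivity), Real.log_pow]
    push_cast; rfl
  have c1 := Real.log_le_sub_one_of_pos (by linarith : 0 < Real.log (2 ^ 62 * q / ρ ^ 3))
  have c2 := Real.log_le_sub_one_of_pos (by linarith : 0 < Real.log (2 ^ 15 * D * q))
  rw [Real.log_mul (by positivity) (by positivity), e]
  have hlDL : Real.log D ≤ Real.log (D * q / ρ) := by rw [hL]; linarith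
  have hadd := add_le_add (c1.trans (sub_le_sub_right b1 1)) (c2.trans (sub_le_sub_right b2 1))
  linarith only [hadd, hlDL, hl2, hlD]

/-- The blocks of the analysis fit into `T` steps. -/
theorem exists_block_parameters (hD : 14 ≤ D) (hq : 1 ≤ q) (hρ : 0 < ρ) (hρ' : ρ ≤ 1) {T : ℕ}
    (hT : paramA D q ρ * Real.log (D * paramA D q ρ) * D ≤ T)
    (hT' : T ≤ 2 * (paramA D q ρ * Real.log (D * paramA D q ρ) * D)) {w : ℝ} (hw : 0 < w)
    (hwq : w ^ 2 = q) :
    ∃ J K : ℕ, (4 * w) ^ 5 < (1 + 1 / (4 * D)) ^ J ∧ J * (K + 1 + 1) ≤ T ∧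
      2 ^ 22 * T ^ 3 * q ^ 3 / ρ ^ 2 ≤ (1 + √2 / 4) ^ K := by
  have h1 := one_le_log_fst hq hρ hρ'
  have h2 := one_le_log_snd hD hq
  have hA := one_le_paramA hD hq hρ hρ'
  have hℓ := two_le_log_mul_paramA hD hq hρ hρ'
  have hlD := two_le_log hD
  have hlq := Real.log_nonneg hq
  have hlρ := Real.log_nonpos hρ.le hρ'
  have hl2 := Real.log_two_lt_d9
  have hl2' := Real.log_two_gt_d9
  set Λ₁ := Real.log (2 ^ 62 * q / ρ ^ 3) with hΛ₁
  set Λ₂ := Real.log (2 ^ 15 * D * q) with hΛ₂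
  set ℓ := Real.log (D * paramA D q ρ) with hℓdef
  have hD0 : 0 < D := by linarith
  have hT0 : (0 : ℝ) < T := lt_of_lt_of_le (by positivity) hT
  have hlogT0 : 0 ≤ Real.log T := by
    refine Real.log_nonneg ?_
    exact_mod_cast Nat.one_le_iff_ne_zero.2 fun h => by rw [h] at hT0; simp at hT0
  have hlogT : Real.log T ≤ 3 * ℓ := by
    have e : Real.log (2 * (paramA D q ρ * ℓ * D)) = Real.log 2 + (ℓ + Real.log ℓ) := by
      rw [Real.log_mul (by positivity) (by positivity),
        show paramA D q ρ * ℓ * D = (D * paramA D q ρ) * ℓ by ring,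
        Real.log_mul (by positivity) (by positivity)]
    have := Real.log_le_log hT0 hT'
    have := Real.log_le_sub_one_of_pos (by linarith : 0 < ℓ)
    linarith
  have hlw : Real.log q = 2 * Real.log w := by rw [← hwq, Real.log_pow]; norm_num
  -- J: log(1 + 1/(4D)) ≥ 1/(8D) turns 20DΛ₂ into 5Λ₂/2, which exceeds 5 log(4w). K: log(1 + √2/4) ≥
  -- 1/4 turns 12(log T + Λ₁) into 3 log T + 3Λ₁. The product J(K + 2) is at most 21 · 51 · DΛ₂ℓΛ₁,
  -- far below 2^27 DΛ₂ℓΛ₁ ≤ T.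
  refine ⟨⌊20 * D * Λ₂⌋₊ + 1, ⌈12 * Real.log T + 12 * Λ₁⌉₊, ?_, ?_, ?_⟩
  · have hJ := Nat.lt_floor_add_one (20 * D * Λ₂)
    rw [← Real.log_lt_log_iff (by positivity) (by positivity), Real.log_pow, Real.log_pow,
      Real.log_mul (by norm_num) hw.ne', show (4 : ℝ) = 2 ^ 2 by norm_num, Real.log_pow]
    have hε : 1 / (8 * D) ≤ Real.log (1 + 1 / (2 ^ 2 * D)) := by
      refine le_trans ?_ (Real.one_sub_inv_le_log_of_pos (by positivity))
      have : 1 - (1 + 1 / (2 ^ 2 * D))⁻¹ = 1 / (4 * D + 1) := by field_simp; ring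
      rw [this]
      exact one_div_le_one_div_of_le (by positivity) (by linarith)
    have hmain : 20 * D * Λ₂ * (1 / (8 * D)) <
        (⌊20 * D * Λ₂⌋₊ + 1 : ℝ) * Real.log (1 + 1 / (2 ^ 2 * D)) :=
      mul_lt_mul hJ hε (by positivity) (by positivity)
    have he : 20 * D * Λ₂ * (1 / (8 * D)) = 5 / 2 * Λ₂ := by field_simp; norm_num
    have hΛ : Λ₂ = 15 * Real.log 2 + Real.log D + Real.log q := log_pow_mul_mul hD hq
    rw [he] at hmain
    push_cast
    linarith
  · have hJ := Nat.floor_le (by positivity : 0 ≤ 20 * D * Λ₂)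
    have hK := Nat.ceil_lt_add_one (by positivity : 0 ≤ 12 * Real.log T + 12 * Λ₁)
    have hDΛ : 1 ≤ D * Λ₂ := one_le_mul_of_one_le_of_one_le (by linarith) h2
    have hJ' : ((⌊20 * D * Λ₂⌋₊ : ℝ) + 1) ≤ 21 * (D * Λ₂) := by linarith
    have hℓΛ : ℓ ≤ ℓ * Λ₁ := le_mul_of_one_le_right (by linarith) h1
    have hΛℓ : Λ₁ ≤ ℓ * Λ₁ := le_mul_of_one_le_left (by linarith) (by linarith)
    have hK' : ((⌈12 * Real.log T + 12 * Λ₁⌉₊ : ℝ) + 1 + 1) ≤ 51 * (ℓ * Λ₁) := by linarith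
    have hmul := mul_le_mul hJ' hK' (by positivity) (by positivity)
    have hpos : 0 ≤ D * Λ₂ * (ℓ * Λ₁) := by positivity
    have hA' : paramA D q ρ * ℓ * D = 2 ^ 27 * (D * Λ₂ * (ℓ * Λ₁)) := by
      rw [paramA]; ring
    rw [hA'] at hT
    have : (((⌊20 * D * Λ₂⌋₊ + 1) * (⌈12 * Real.log T + 12 * Λ₁⌉₊ + 1 + 1) : ℕ) : ℝ) ≤ T := by
      push_cast; linarith
    exact_mod_cast this
  · have hK := Nat.le_ceil (12 * Real.log T + 12 * Λ₁)
    rw [← Real.log_le_log_iff (by positivity) (by positivity), Real.log_pow,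
      Real.log_div (by positivity) (by positivity), Real.log_mul (by positivity) (by positivity),
      Real.log_mul (by positivity) (by positivity), Real.log_pow, Real.log_pow, Real.log_pow,
      Real.log_pow]
    have hr : 1 / 4 ≤ Real.log (1 + √2 / 4) := by
      have hs : 1.4 ≤ √2 := Real.le_sqrt_of_sq_le (by norm_num)
      have := Real.one_sub_inv_le_log_of_pos (by positivity : 0 < 1 + √2 / 4)
      have h3 : (1 + √2 / 4)⁻¹ ≤ 3 / 4 := by
        rw [inv_le_comm₀ (by positivity) (by norm_num)]; linarith
      linarith
    have hmul := mul_le_mul hK hr (by norm_num) (Nat.cast_nonneg _)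
    have hΛ : Λ₁ = 62 * Real.log 2 + Real.log q - 3 * Real.log ρ := log_mul_div_pow hq hρ
    push_cast
    linarith

end Parameters

/-! ### Bounds on the constants and assembly of the theorem. -/

section Main

variable {d : ℕ} {μ ρ : ℝ} {θ₀ v : Param d}

theorem fourteen_le_sqrt_div (hd : 2 ≤ d) (hμ : 0 < μ) (hμ' : μ ≤ 1 / 10) :
    14 ≤ √(d : ℝ) / μ := by
  have hd' : (2 : ℝ) ≤ d := by exact_mod_cast hd
  have hs : 1.4 ≤ √(d : ℝ) := Real.le_sqrt_of_sq_le (by norm_num; linarith)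
  rw [le_div_iff₀ hμ]; linarith

theorem abs_inner_le_norm_of_norm_eq_one (hv : ‖v‖ = 1) : |inner ℝ θ₀ v| ≤ ‖θ₀‖ := by
  have := abs_real_inner_le_norm θ₀ v
  rwa [hv, mul_one] at this

theorem one_le_norm_sq_div_inner_sq (hv : ‖v‖ = 1) (hθ : inner ℝ θ₀ v ≠ 0) :
    1 ≤ ‖θ₀‖ ^ 2 / inner ℝ θ₀ v ^ 2 := by
  rw [one_le_div (by positivity), ← sq_abs (inner ℝ θ₀ v)]
  gcongr
  exact abs_inner_le_norm_of_norm_eq_one hv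

theorem stepsT_bounds (hd : 2 ≤ d) (hμ : 0 < μ) (hμ' : μ ≤ 1 / 10) (hρ : 0 < ρ) (hρ' : ρ ≤ 1)
    (hv : ‖v‖ = 1) (hθ : inner ℝ θ₀ v ≠ 0) :
    1 ≤ constA d μ ρ θ₀ v ∧ 2 ≤ Real.log (√(d : ℝ) / μ * constA d μ ρ θ₀ v) ∧
      constB d μ ρ θ₀ v * (√(d : ℝ) / μ) ≤ stepsT d μ ρ θ₀ v ∧
      stepsT d μ ρ θ₀ v ≤ 2 * (constB d μ ρ θ₀ v * (√(d : ℝ) / μ)) := by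
  have hD := fourteen_le_sqrt_div hd hμ hμ'
  have hq := one_le_norm_sq_div_inner_sq hv hθ
  have hA := one_le_paramA hD hq hρ hρ'
  have hℓ := two_le_log_mul_paramA hD hq hρ hρ'
  rw [← constA_eq] at hA hℓ
  have hB : 1 ≤ constB d μ ρ θ₀ v := one_le_mul_of_one_le_of_one_le hA (by linarith)
  have hBD : 1 ≤ constB d μ ρ θ₀ v * (√(d : ℝ) / μ) :=
    one_le_mul_of_one_le_of_one_le hB (by linarith)
  refine ⟨hA, hℓ, Nat.le_ceil _, ?_⟩
  have := Nat.ceil_lt_add_one (zero_le_one.trans hBD)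
  rw [stepsT]; linarith

/-- Here 7525 = 175 · 43 comes from `paramA_bounds`, and the passage from 2^27 to 2^28 pays for the
ceiling in T. -/
theorem constants_bounds (hd : 2 ≤ d) (hμ : 0 < μ) (hμ' : μ ≤ 1 / 10) (hρ : 0 < ρ) (hρ' : ρ ≤ 1)
    (hv : ‖v‖ = 1) (hθ : inner ℝ θ₀ v ≠ 0) :
    (1 ≤ constA d μ ρ θ₀ v ∧ constA d μ ρ θ₀ v ≤ 2 ^ 28 * 7525 * logFactor d μ ρ θ₀ v ^ 2) ∧
      (1 ≤ constB d μ ρ θ₀ v ∧ constB d μ ρ θ₀ v ≤ 2 ^ 28 * 7525 * logFactor d μ ρ θ₀ v ^ 3) ∧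
      (√(d : ℝ) / μ ≤ stepsT d μ ρ θ₀ v ∧ stepsT d μ ρ θ₀ v ≤
        2 ^ 28 * 7525 * logFactor d μ ρ θ₀ v ^ 3 * (√(d : ℝ) / μ)) := by
  have hD := fourteen_le_sqrt_div hd hμ hμ'
  have hq := one_le_norm_sq_div_inner_sq hv hθ
  obtain ⟨hA, hℓ, hT, hT'⟩ := stepsT_bounds hd hμ hμ' hρ hρ' hv hθ
  obtain ⟨h1, h2⟩ := paramA_bounds hD hq hρ hρ'
  rw [← constA_eq, ← logFactor_eq] at h1 h2
  have hL : 0 ≤ logFactor d μ ρ θ₀ v := by linarith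
  have hB : 1 ≤ constB d μ ρ θ₀ v := one_le_mul_of_one_le_of_one_le hA (by linarith)
  have hB' : constB d μ ρ θ₀ v ≤ 2 ^ 27 * 7525 * logFactor d μ ρ θ₀ v ^ 3 := by
    refine (mul_le_mul h1 h2 (by linarith) (by positivity)).trans (le_of_eq (by ring))
  have hL2 := pow_nonneg hL 2
  have hL3 := pow_nonneg hL 3
  refine ⟨⟨hA, by linarith⟩, ⟨hB, by linarith⟩, ?_, hT'.trans ?_⟩
  · exact (le_mul_of_one_le_left (by linarith) hB).trans hT
  · have := mul_le_mul_of_nonneg_right hB' (by linarith : 0 ≤ √(d : ℝ) / μ)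
    linarith

end Main

/-- A separator is found within `T` steps with probability at least `1 - ρ`. -/
theorem one_sub_le_measureReal_separator {n : ℕ} {μ ρ : ℝ} {θ₀ v : Param (n + 2)}
    (hμ : 0 < μ) (hμ' : μ ≤ 1 / 10) (hρ : 0 < ρ) (hρ' : ρ ≤ 1) (hv₁ : ‖v‖ = 1)
    (hv : act (A2 (n + 2) μ) v = μ • v) (hθ : inner ℝ θ₀ v ≠ 0)
    {Ω : Type*} [MeasurableSpace Ω] {P : Measure Ω} [IsProbabilityMeasure P]
    {ξ : ℕ → Ω → Param (n + 2)} (hindep : iIndepFun ξ P)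
    (hlaw : ∀ t, HasLaw (ξ t) (multivariateGaussian 0 (noiseLevel (n + 2) μ ρ θ₀ v ^ 2 •
      (1 : Matrix (Fin 2 ⊕ Fin (n + 2)) (Fin 2 ⊕ Fin (n + 2)) ℝ))) P) :
    1 - ρ ≤ P.real {ω | ∃ t ≤ stepsT (n + 2) μ ρ θ₀ v,
      IsSeparator (n + 2) μ (orbit n μ θ₀ (fun s => ξ s ω) t)} := by
  have hd : 2 ≤ n + 2 := by omega
  have hD := fourteen_le_sqrt_div hd hμ hμ'
  have hq := one_le_norm_sq_div_inner_sq hv₁ hθ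
  obtain ⟨hA, hℓ, hT, hT'⟩ := stepsT_bounds hd hμ hμ' hρ hρ' hv₁ hθ
  have hDT := (constants_bounds hd hμ hμ' hρ hρ' hv₁ hθ).2.2.1
  have hα : 0 < |inner ℝ θ₀ v| := abs_pos.2 hθ
  have hαθ : |inner ℝ θ₀ v| ≤ ‖θ₀‖ := abs_inner_le_norm_of_norm_eq_one hv₁
  have hw1 : 1 ≤ ‖θ₀‖ / |inner ℝ θ₀ v| := (one_le_div hα).2 hαθ
  have hwq : (‖θ₀‖ / |inner ℝ θ₀ v|) ^ 2 = ‖θ₀‖ ^ 2 / inner ℝ θ₀ v ^ 2 := by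
    rw [div_pow, sq_abs]
  rw [constB, constA_eq] at hT hT'
  obtain ⟨J, K, hJ, hJT, hK⟩ :=
    exists_block_parameters hD hq hρ hρ' hT hT' (by linarith : 0 < ‖θ₀‖ / |inner ℝ θ₀ v|) hwq
  set σ := noiseLevel (n + 2) μ ρ θ₀ v with hσdef
  set T := stepsT (n + 2) μ ρ θ₀ v with hTdef
  set M := max ((n + 2 : ℕ) : ℝ) (Real.log (T / ρ)) with hMdef
  set w := ‖θ₀‖ / |inner ℝ θ₀ v| with hw
  have hT0 : (0 : ℝ) < T := by linarith
  have hM0 : 0 < M := lt_of_lt_of_le (by positivity) (le_max_left _ _)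
  have hσ : σ = |inner ℝ θ₀ v| / (4096 * T * √M) := rfl
  have hσ0 : 0 < σ := by rw [hσ]; positivity
  -- This removes M from the requirement on K: d is controlled by T ≥ √d/μ, and the logarithm by log
  -- x ≤ x².
  have hMT : √M ≤ T / ρ := by
    have hTρ : (T : ℝ) ≤ T / ρ := le_div_self hT0.le hρ hρ'
    refine Real.sqrt_le_iff.2 ⟨by positivity, max_le ?_ ?_⟩
    · have h1 : √((n + 2 : ℕ) : ℝ) ≤ T / ρ :=
        ((le_div_self (Real.sqrt_nonneg _) hμ (by linarith)).trans hDT).trans hTρ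
      calc ((n + 2 : ℕ) : ℝ) = √((n + 2 : ℕ) : ℝ) ^ 2 :=
            (Real.sq_sqrt (Nat.cast_nonneg _)).symm
        _ ≤ (T / ρ) ^ 2 := by gcongr
    · have h1 := Real.log_le_sub_one_of_pos (div_pos hT0 hρ)
      have h2 : 1 ≤ T / ρ := by linarith
      nlinarith
  have hsmall : 1024 * ‖θ₀‖ ^ 5 / |inner ℝ θ₀ v| ^ 4 /
      ((1 + √2 / 4) ^ K * (2 * σ)) ≤ ρ / (2 * T) := by
    have hΔ : 1024 * ‖θ₀‖ ^ 5 / |inner ℝ θ₀ v| ^ 4 = 1024 * w ^ 5 * |inner ℝ θ₀ v| := by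
      rw [hw, div_pow]; field_simp
    -- The exponent 5 is rounded up to 6 to obtain a power of q = w².
    have hw56 : w ^ 5 ≤ (‖θ₀‖ ^ 2 / inner ℝ θ₀ v ^ 2) ^ 3 := by
      rw [← hwq, ← pow_mul]; exact pow_le_pow_right₀ hw1 (by norm_num)
    have hchain : 2 ^ 22 * T ^ 2 * √M * w ^ 5 / ρ ≤ (1 + √2 / 4) ^ K := by
      refine le_trans ?_ hK
      calc 2 ^ 22 * T ^ 2 * √M * w ^ 5 / ρ
          ≤ 2 ^ 22 * T ^ 2 * (T / ρ) * (‖θ₀‖ ^ 2 / inner ℝ θ₀ v ^ 2) ^ 3 / ρ := by gcongr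
        _ = _ := by field_simp
    rw [hΔ, div_le_div_iff₀ (by positivity) (by positivity), hσ]
    rw [div_le_iff₀ hρ] at hchain
    have hsM : 0 < √M := Real.sqrt_pos.2 hM0
    have key : 1024 * w ^ 5 * |inner ℝ θ₀ v| * (2 * T) =
        2 ^ 22 * T ^ 2 * √M * w ^ 5 * (2 * (|inner ℝ θ₀ v| / (4096 * T * √M))) := by
      field_simp; norm_num
    rw [key]
    calc _ ≤ (1 + √2 / 4) ^ K * ρ * (2 * (|inner ℝ θ₀ v| / (4096 * T * √M))) := by gcongr
      _ = _ := by ring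
  refine one_sub_le_measureReal_of_compl (f := fun t => {ω | 4 * σ * √M < ‖ξ t ω‖})
    (g := fun t => {ω | |(1 + √2 / 4) ^ (K + 1) * escape (orbit n μ θ₀ (fun s => ξ s ω) t) +
      ∑ i ∈ Finset.range (K + 1), (1 + √2 / 4) ^ (K + 1 - 1 - i) * escape (ξ (t + i) ω)| ≤
        1024 * ‖θ₀‖ ^ 5 / |inner ℝ θ₀ v| ^ 4}) (T := T) (by exact_mod_cast hT0)
    (fun t _ => measureReal_norm_noise_gt_le hd hσ0 (hlaw t) hT0 hρ (le_max_left _ _)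
      (le_max_right _ _))
    (fun t _ => (measureReal_escape_le hσ0 hindep hlaw t K (by positivity)).trans hsmall) ?_
  intro ω hω
  -- With this R the choice of σ makes T · R equal to α/1024. The shift to K + 1 leaves the weight
  -- (1 + √2/4)^K on the first noise vector of a block.
  refine exists_separator hμ hμ' hv₁ hv hθ (R := 4 * σ * √M) (K := K + 1) (J := J)
    (fun t ht => not_lt.1 (hω t ht).1) ?_ (fun t ht => not_le.1 (hω t ht).2) ?_ hJT
  · rw [hσ]
    have hsM : 0 < √M := Real.sqrt_pos.2 hM0
    refine le_of_eq ?_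
    field_simp; norm_num
  · have e : growthRate (n + 2) μ = 1 / (4 * (√((n + 2 : ℕ) : ℝ) / μ)) := by
      rw [growthRate, stepSize]; field_simp
    rw [e, mul_div_assoc]
    exact hJ

end QuadPerceptron

end

theorem mainTheorem1 :
    ∃ C : ℝ, 0 < C ∧
      ∀ (d : ℕ) (μ ρ : ℝ) (θ₀ v : QuadPerceptron.Param d),
        2 ≤ d → 0 < μ → μ ≤ 1 / 10 → 0 < ρ → ρ ≤ 1 →
        -- `v = v_{μ,+}` is a unit eigenvector of `A₂` with eigenvalue `μ`
        ‖v‖ = 1 → QuadPerceptron.act (QuadPerceptron.A2 d μ) v = μ • v →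
        inner ℝ θ₀ v ≠ 0 →
        -- the constants `A`, `B` are `Θ̃(1)` and `T` is `Θ̃(√d / μ)`
        ((1 ≤ QuadPerceptron.constA d μ ρ θ₀ v ∧
            QuadPerceptron.constA d μ ρ θ₀ v ≤ C * QuadPerceptron.logFactor d μ ρ θ₀ v ^ 2) ∧
          (1 ≤ QuadPerceptron.constB d μ ρ θ₀ v ∧
            QuadPerceptron.constB d μ ρ θ₀ v ≤ C * QuadPerceptron.logFactor d μ ρ θ₀ v ^ 3) ∧
          (√(d : ℝ) / μ ≤ (QuadPerceptron.stepsT d μ ρ θ₀ v : ℝ) ∧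
            (QuadPerceptron.stepsT d μ ρ θ₀ v : ℝ) ≤
              C * QuadPerceptron.logFactor d μ ρ θ₀ v ^ 3 * (√(d : ℝ) / μ))) ∧
        -- a separator is found within `T` steps with probability at least `1 - ρ`
        ∀ {Ω : Type*} [MeasurableSpace Ω] (P : Measure Ω) [IsProbabilityMeasure P]
          (ξ : ℕ → Ω → QuadPerceptron.Param d),
          iIndepFun ξ P →
          (∀ t, HasLaw (ξ t)
            (multivariateGaussian 0
              (QuadPerceptron.noiseLevel d μ ρ θ₀ v ^ 2 •
                (1 : Matrix (Fin 2 ⊕ Fin d) (Fin 2 ⊕ Fin d) ℝ))) P) →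
          1 - ρ ≤ P.real {ω | ∃ t ≤ QuadPerceptron.stepsT d μ ρ θ₀ v,
            QuadPerceptron.IsSeparator d μ
              (QuadPerceptron.iterates d μ (QuadPerceptron.stepSize d) θ₀
                (fun s => ξ s ω) t)} := by
  refine ⟨2 ^ 28 * 7525, by norm_num, ?_⟩
  intro d μ ρ θ₀ v hd hμ hμ' hρ hρ' hv₁ hv hθ
  refine ⟨QuadPerceptron.constants_bounds hd hμ hμ' hρ hρ' hv₁ hθ, ?_⟩
  intro Ω _ P _ ξ hindep hlaw
  -- In the form n + 2 the index type has the literals 0 and 1, the two positions where b₂ and its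
  -- shift carry the perturbation.
  obtain ⟨n, rfl⟩ : ∃ n, d = n + 2 := ⟨d - 2, by omega⟩
  exact QuadPerceptron.one_sub_le_measureReal_separator hμ hμ' hρ hρ' hv₁ hv hθ hindep hlaw
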